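/- Let $G$ be a plane graph, i.e. a finite connected undirected graph (loops and parallel edges allowed) embedded in the plane without edge crossings, and let $e$ be an edge of $G$. The dual graph $G^*$ has a vertex for each (bounded or unbounded) face of $G$ and, for each edge $f$ of $G$, a dual edge $f'$ connecting the two faces separated by $f$ (a loop if both sides of $f$ belong to the same face). A cycle of a graph is a connected 2-regular subgraph (a loop counts twice in the degree of its vertex), and it is Hamiltonian if it contains every vertex of the graph. A cycle basis of $G$ is a set of cycles of $G$ whose edge sets form a basis of the cycle space of $G$, the subspace of $\mathbb{F}_2^{E(G)}$ spanned by the edge sets of all cycles of $G$. For a spanning tree $T$ of $G$, the fundamental cycle of an edge $f\notin T$ consists of $f$ and the path in $T$ connecting the endpoints of $f$; the set of all these cycles is the fundamental cycle basis of $T$. A set of cycles is rooted at $e$ if all of its cycles contain $e$. (1) For every spanning tree $T$ of $G$ that contains $e$, the fundamental cycle basis of $T$ is rooted at $e$ if and only if the set of edges dual to the edges in $(E(G)\setminus E(T))\cup\{e\}$ is the edge set of a Hamiltonian cycle of $G^*$. (2) Suppose that $e$ is not a loop. Then $G$ has a cycle basis rooted at $e$ that is the fundamental cycle basis of some spanning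 tree of $G$ if and only if $G^*$ has a Hamiltonian cycle that contains the dual edge $e'$ of $e$. -/

import Mathlib

open scoped Graph

namespace Graph

variable {α β : Type*}

/-! ### Multigraphs: connectedness, cycles, trees -/

/-- A multigraph is connected if it has a vertex and any two vertices are joined by a walk. -/
def Connected (G : Graph α β) : Prop :=
  V(G).Nonempty ∧ ∀ x ∈ V(G), ∀ y ∈ V(G), Relation.ReflTransGen G.Adj x y

/-- The degree of a vertex of a (locally finite) multigraph; a loop contributes two. -/
noncomputable def degree (G : Graph α β) (v : α) : ℕ :=
  {f | G.IsNonloopAt f v}.ncard + 2 * (G.loopSet v).ncard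

/-- A cycle is a connected 2-regular graph. (A vertex with one loop and two vertices joined by
two parallel edges are cycles of length one and two.) -/
def IsCycle (C : Graph α β) : Prop :=
  C.Connected ∧ ∀ v ∈ V(C), C.degree v = 2

/-- `C` is a Hamiltonian cycle of `G`: a cycle of `G` that contains every vertex of `G`. -/
def IsHamiltonianCycle (G C : Graph α β) : Prop :=
  C ≤ G ∧ C.IsCycle ∧ V(C) = V(G)

/-- `T` is a spanning tree of `G`: a connected subgraph that includes all vertices of `G` and
contains no cycle. -/
def IsSpanningTree (G T : Graph α β) : Prop :=
  T ≤ G ∧ V(T) = V(G) ∧ T.Connected ∧ ∀ C : Graph α β, C ≤ T → ¬ C.IsCycle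

/-- `P` is a simple path with endpoints `x` and `y`: a connected graph in which `x` and `y` have
degree one and all other vertices have degree two; if `x = y`, the path consists of the single
vertex `x` and has no edges. -/
def IsSimplePath (P : Graph α β) (x y : α) : Prop :=
  P.Connected ∧ x ∈ V(P) ∧ y ∈ V(P) ∧
    (x = y → V(P) = {x} ∧ E(P) = ∅) ∧
    (x ≠ y → P.degree x = 1 ∧ P.degree y = 1 ∧ ∀ v ∈ V(P), v ≠ x → v ≠ y → P.degree v = 2)

/-- The fundamental cycles of `G` for the spanning tree `T`: for each edge `f` of `G` not in `T`,
the subgraph of `G` consisting of `f` and the path in `T` connecting the endpoints of `f`. -/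
def fundamentalCycles (G T : Graph α β) : Set (Graph α β) :=
  {C | C ≤ G ∧ ∃ f x y, f ∉ E(T) ∧ G.IsLink f x y ∧
    ∃ P : Graph α β, P ≤ T ∧ P.IsSimplePath x y ∧ V(C) = V(P) ∧ E(C) = insert f E(P)}

/-! ### Cycle bases -/

/-- The edge set of a graph, as a vector over the field with two elements. -/
noncomputable def edgeVec (C : Graph α β) : β → ZMod 2 :=
  E(C).indicator 1

/-- The cycle space of `G`: the span over the field with two elements of the edge sets of the
cycles of `G`. (All its vectors vanish outside `E(G)`.) -/
noncomputable def cycleSpace (G : Graph α β) : Submodule (ZMod 2) (β → ZMod 2) :=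
  Submodule.span (ZMod 2) (edgeVec '' {C : Graph α β | C ≤ G ∧ C.IsCycle})

/-- A cycle basis of `G` is a set of cycles of `G` whose edge sets form a basis of the
cycle space. -/
def IsCycleBasis (G : Graph α β) (B : Set (Graph α β)) : Prop :=
  (∀ C ∈ B, C ≤ G ∧ C.IsCycle) ∧
    LinearIndepOn (ZMod 2) (edgeVec : Graph α β → β → ZMod 2) B ∧
    Submodule.span (ZMod 2) (edgeVec '' B) = G.cycleSpace

/-- A set of cycles is rooted at `e` if all its members contain the edge `e`. -/
def IsRootedAt (B : Set (Graph α β)) (e : β) : Prop :=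
  ∀ C ∈ B, e ∈ E(C)

/-- `B` is a rooted fundamental cycle basis of `G` with root edge `e`. -/
def IsRootedFundamentalCycleBasis (G : Graph α β) (e : β) (B : Set (Graph α β)) : Prop :=
  G.IsCycleBasis B ∧ (∃ T : Graph α β, G.IsSpanningTree T ∧ B = G.fundamentalCycles T) ∧
    IsRootedAt B e

/-! ### Plane graphs and their duals -/

/-- An embedding of the multigraph `G` in the plane `ℂ` without edge crossings. Vertices are
distinct points; each edge is a curve joining its ends that does not meet itself (a loop being
closed) and does not pass through vertices in its interior, and the interiors of distinct edges are
disjoint. (Values of `pos` and `arc` outside `V(G)` and `E(G)` play no role.) -/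
structure PlaneEmbedding (G : Graph α β) where
  pos : α → ℂ
  arc : β → C(unitInterval, ℂ)
  pos_injOn : Set.InjOn pos V(G)
  arc_ends : ∀ f x y, G.IsLink f x y →
    (arc f 0 = pos x ∧ arc f 1 = pos y) ∨ (arc f 0 = pos y ∧ arc f 1 = pos x)
  arc_simple : ∀ f ∈ E(G), ∀ s t : unitInterval, arc f s = arc f t →
    s = t ∨ (s = 0 ∧ t = 1) ∨ (s = 1 ∧ t = 0)
  arc_ne_pos : ∀ f ∈ E(G), ∀ t ∈ Set.Ioo (0 : unitInterval) 1, ∀ v ∈ V(G), arc f t ≠ pos v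
  arc_disjoint : ∀ f ∈ E(G), ∀ g ∈ E(G), f ≠ g →
    ∀ s ∈ Set.Ioo (0 : unitInterval) 1, ∀ t ∈ Set.Ioo (0 : unitInterval) 1, arc f s ≠ arc g t

namespace PlaneEmbedding

variable {G : Graph α β}

/-- The point set of the drawing: all vertices and all edges. -/
def support (D : G.PlaneEmbedding) : Set ℂ :=
  D.pos '' V(G) ∪ ⋃ f ∈ E(G), Set.range (D.arc f)

/-- The faces, bounded or unbounded: the connected components of the complement of the drawing. -/
def faces (D : G.PlaneEmbedding) : Set (Set ℂ) :=
  {F | ∃ p ∈ D.supportᶜ, F = connectedComponentIn D.supportᶜ p}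

/-- An edge without its endpoints, as a point set. -/
def openArc (D : G.PlaneEmbedding) (f : β) : Set ℂ :=
  D.arc f '' Set.Ioo 0 1

/-- The faces on the two sides of an edge: those that have the edge on their boundary. -/
def sides (D : G.PlaneEmbedding) (f : β) : Set (Set ℂ) :=
  {F | F ∈ D.faces ∧ D.openArc f ⊆ frontier F}

/-- The dual graph. Its vertices are the faces; the dual of the edge `f` has the same name `f` and
connects the two faces that `f` separates. It is a loop if `f` has the same face on both sides. -/
def dual (D : G.PlaneEmbedding) : Graph (Set ℂ) β where
  vertexSet := D.faces
  IsLink f F F' := f ∈ E(G) ∧ D.sides f = {F, F'}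
  isLink_symm _ _ := ⟨fun _ _ h => ⟨h.1, h.2.trans (Set.pair_comm _ _)⟩⟩
  eq_or_eq_of_isLink_of_isLink := by
    rintro f F F' H H' ⟨-, h⟩ ⟨-, h'⟩
    have : F ∈ ({H, H'} : Set (Set ℂ)) := by
      rw [← h', h]
      exact Set.mem_insert _ _
    simpa using this
  left_mem_of_isLink := by
    rintro f F F' ⟨-, h⟩
    have : F ∈ D.sides f := by
      rw [h]
      exact Set.mem_insert _ _
    exact this.1

end PlaneEmbedding

end Graph

/-! The proof separates combinatorics from plane topology through the abstract relation `IsDual`: an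
edge set connects the dual exactly when the remaining edges are acyclic in the primal graph.

Combinatorially, Hamiltonian cycles are the minimal edge sets that still connect all vertices after
the loss of any one edge (`exists_isHamiltonianCycle_iff`). Under duality, S is such a set when the
complement of S stays acyclic after adding any one edge of S, but not after adding two. For S
consisting of the non-tree edges and e, the complement is T - e. Now T - e + f is acyclic exactly
when the fundamental cycle of f passes through e, and then T - e + f is again a spanning tree, so no
second edge fits. This gives (1), `IsDual.isRootedAt_iff`. Conversely, a dual Hamiltonian cycle
through e yields the tree made of e and the edges off the cycle. The only other case in (2) is a
rooted basis whose tree misses e: then e is the only non-tree edge, and e together with another edge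
of the unique cycle forms a dual Hamiltonian cycle of length two.

Topologically, `isDual_dual` compares both conditions with connectedness of the plane minus the
drawing of the complementary edges. Faces are glued across the deleted edges, which requires that
each edge has one or two sides (`exists_sides`). Forests do not separate the plane and cycles do.
All of this rests on Eilenberg's criterion: p and q lie in one component of the complement of a
compact set K if and only if (z - p)/(z - q) has a continuous logarithm on K
(`hasLog_of_mem_component`, `mem_component_of_hasLog`). Attaching an arc to K then becomes a
question about an integer, the jump of the logarithm along the arc. -/

namespace Graph

variable {α β : Type*}

/-! ### Reachability along a set of edges -/

/-- `G.Reach S x y`: there is a walk from `x` to `y` in `G` that uses only edges from `S`. -/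
def Reach (G : Graph α β) (S : Set β) : α → α → Prop :=
  Relation.ReflTransGen fun x y => ∃ f ∈ S, G.IsLink f x y

section Reach

variable {G H : Graph α β} {S S' : Set β} {x y z : α} {f : β}

lemma Reach.refl (G : Graph α β) (S : Set β) (x : α) : G.Reach S x x :=
  Relation.ReflTransGen.refl

lemma Reach.trans (h : G.Reach S x y) (h' : G.Reach S y z) : G.Reach S x z :=
  Relation.ReflTransGen.trans h h'

lemma Reach.symm (h : G.Reach S x y) : G.Reach S y x := by
  induction h with
  | refl => exact .refl _ _ _
  | tail _ hl ih =>
    obtain ⟨g, hg, hl⟩ := hl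
    exact Relation.ReflTransGen.head ⟨g, hg, hl.symm⟩ ih

lemma IsLink.reach (h : G.IsLink f x y) (hf : f ∈ S) : G.Reach S x y :=
  Relation.ReflTransGen.single ⟨f, hf, h⟩

lemma Reach.lift (h : G.Reach S x y)
    (hS : ∀ f ∈ S, ∀ a b, G.IsLink f a b → H.Reach S' a b) : H.Reach S' x y := by
  induction h with
  | refl => exact .refl _ _ _
  | tail _ hl ih =>
    obtain ⟨g, hg, hl⟩ := hl
    exact ih.trans (hS g hg _ _ hl)

lemma Reach.mono (h : G.Reach S x y) (hS : S ⊆ S') : G.Reach S' x y :=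
  h.lift fun _ hf _ _ hl => hl.reach (hS hf)

lemma Reach.of_le (h : H.Reach S x y) (hHG : H ≤ G) : G.Reach S x y :=
  h.lift fun _ hf _ _ hl => (hl.mono hHG).reach hf

lemma Reach.anti (h : G.Reach S x y) (hHG : H ≤ G) (hS : S ⊆ E(H)) : H.Reach S x y :=
  h.lift fun _ hf _ _ hl => ((hHG.isLink_iff (hS hf)).2 hl).reach hf

lemma Reach.closed (h : G.Reach S x y) {X : Set α} (hx : x ∈ X)
    (hX : ∀ f ∈ S, ∀ a b, G.IsLink f a b → a ∈ X → b ∈ X) : y ∈ X := by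
  induction h with
  | refl => exact hx
  | tail _ hl ih =>
    obtain ⟨g, hg, hl⟩ := hl
    exact hX g hg _ _ hl ih

lemma connected_iff_reach (G : Graph α β) :
    G.Connected ↔ V(G).Nonempty ∧ ∀ x ∈ V(G), ∀ y ∈ V(G), G.Reach E(G) x y := by
  have : G.Adj = fun x y => ∃ f ∈ E(G), G.IsLink f x y := by
    ext x y
    exact ⟨fun ⟨f, hf⟩ => ⟨f, hf.edge_mem, hf⟩, fun ⟨f, _, hf⟩ => ⟨f, hf⟩⟩
  unfold Connected Reach
  rw [this]

/-- Deleting an edge whose ends remain connected preserves reachability. -/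
lemma Reach.of_insert (h : G.Reach (insert f S) x y) {a b : α} (hf : G.IsLink f a b)
    (hab : G.Reach S a b) : G.Reach S x y := by
  refine h.lift ?_
  rintro g (rfl | hg) c d hl
  · obtain ⟨rfl, rfl⟩ | ⟨rfl, rfl⟩ := hl.eq_and_eq_or_eq_and_eq hf
    · exact hab
    · exact hab.symm
  · exact hl.reach hg

/-- After deleting an edge, each vertex that was reachable from an end of the edge is still
reachable from one of its ends. -/
lemma Reach.left_or_right {a b : α} (h : G.Reach S a x) (hf : G.IsLink f a b) :
    G.Reach (S \ {f}) a x ∨ G.Reach (S \ {f}) b x := by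
  refine h.closed (X := {x | G.Reach (S \ {f}) a x ∨ G.Reach (S \ {f}) b x})
    (Or.inl (.refl _ _ _)) ?_
  rintro g hg c d hl hc
  by_cases hgf : g = f
  · subst hgf
    obtain ⟨rfl, rfl⟩ | ⟨rfl, rfl⟩ := hl.eq_and_eq_or_eq_and_eq hf
    · exact Or.inr (.refl _ _ _)
    · exact Or.inl (.refl _ _ _)
  · exact hc.imp (·.trans (hl.reach ⟨hg, hgf⟩)) (·.trans (hl.reach ⟨hg, hgf⟩))

end Reach

/-! ### Subgraphs with given vertices and edges, degrees -/

/-- The subgraph with vertices from `V` and those edges from `E` that have both ends in `V`. -/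
def sub (G : Graph α β) (V : Set α) (E : Set β) : Graph α β where
  vertexSet := V ∩ V(G)
  IsLink f x y := f ∈ E ∧ G.IsLink f x y ∧ x ∈ V ∧ y ∈ V
  isLink_symm _ _ := ⟨fun _ _ h => ⟨h.1, h.2.1.symm, h.2.2.2, h.2.2.1⟩⟩
  eq_or_eq_of_isLink_of_isLink := fun _ _ _ _ _ h h' => h.2.1.left_eq_or_eq h'.2.1
  left_mem_of_isLink := fun _ _ _ h => ⟨h.2.2.1, h.2.1.left_mem⟩

lemma sub_le (G : Graph α β) (V : Set α) (E : Set β) : G.sub V E ≤ G :=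
  ⟨Set.inter_subset_right, fun _ _ _ h => h.2.1⟩

lemma vertexSet_sub {G : Graph α β} {V : Set α} (E : Set β) (hV : V ⊆ V(G)) :
    V(G.sub V E) = V := Set.inter_eq_left.2 hV

lemma edgeSet_sub {G : Graph α β} {V : Set α} {E : Set β} (hE : E ⊆ E(G))
    (hV : ∀ f ∈ E, ∀ x y, G.IsLink f x y → x ∈ V) : E(G.sub V E) = E := by
  ext f
  constructor
  · rintro ⟨x, y, h⟩
    exact h.1
  · intro hf
    obtain ⟨x, y, h⟩ := G.exists_isLink_of_mem_edgeSet (hE hf)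
    exact ⟨x, y, hf, h, hV f hf _ _ h, hV f hf _ _ h.symm⟩

/-- The degree of a vertex with respect to a set of edges. -/
noncomputable def degreeOn (G : Graph α β) (E : Set β) (v : α) : ℕ :=
  {f | f ∈ E ∧ G.IsNonloopAt f v}.ncard + 2 * {f | f ∈ E ∧ G.IsLoopAt f v}.ncard

section Degree

variable {G H C : Graph α β} {E : Set β} {x y v : α} {f : β}

lemma degree_eq_degreeOn (h : H ≤ G) (v : α) : H.degree v = G.degreeOn E(H) v := by
  unfold degree degreeOn loopSet
  congr 3
  · ext f
    exact ⟨fun hf => ⟨hf.edge_mem, hf.mono h⟩, fun hf => (h.isNonloopAt_congr hf.1).2 hf.2⟩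
  · ext f
    exact ⟨fun hf => ⟨hf.edge_mem, hf.mono h⟩, fun hf => (h.isLoopAt_congr hf.1).2 hf.2⟩

lemma degreeOn_eq_zero (h : ∀ f ∈ E, ¬ G.Inc f v) : G.degreeOn E v = 0 := by
  have h1 : {f | f ∈ E ∧ G.IsNonloopAt f v} = ∅ :=
    Set.eq_empty_of_forall_notMem fun f hf => h f hf.1 hf.2.inc
  have h2 : {f | f ∈ E ∧ G.IsLoopAt f v} = ∅ :=
    Set.eq_empty_of_forall_notMem fun f hf => h f hf.1 hf.2.inc
  simp [degreeOn, h1, h2]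

lemma exists_inc_of_degreeOn_ne_zero (h : G.degreeOn E v ≠ 0) : ∃ f ∈ E, G.Inc f v := by
  by_contra! h'
  exact h (degreeOn_eq_zero h')

lemma IsLink.isNonloopAt_iff (h : G.IsLink f x y) (hxy : x ≠ y) :
    G.IsNonloopAt f v ↔ v = x ∨ v = y := by
  constructor
  · exact fun hv => hv.inc.eq_or_eq_of_isLink h
  · rintro (rfl | rfl)
    · exact ⟨y, hxy.symm, h⟩
    · exact ⟨x, hxy, h.symm⟩

lemma IsLink.not_isLoopAt (h : G.IsLink f x y) (hxy : x ≠ y) : ¬ G.IsLoopAt f v := fun hv =>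
  ((h.isNonloopAt_iff hxy).2 (Or.inl rfl)).not_isLoopAt v hv

open Classical in
lemma degreeOn_insert (hE : E.Finite) (h : G.IsLink f x y) (hxy : x ≠ y) (hf : f ∉ E) (v : α) :
    G.degreeOn (insert f E) v = G.degreeOn E v + if v = x ∨ v = y then 1 else 0 := by
  have h2 : {g | g ∈ insert f E ∧ G.IsLoopAt g v} = {g | g ∈ E ∧ G.IsLoopAt g v} := by
    ext g
    constructor
    · rintro ⟨rfl | hg, hl⟩
      · exact (h.not_isLoopAt hxy hl).elim
      · exact ⟨hg, hl⟩
    · exact fun hg => ⟨Or.inr hg.1, hg.2⟩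
  unfold degreeOn
  rw [h2]
  split_ifs with hv
  · have h1 : {g | g ∈ insert f E ∧ G.IsNonloopAt g v} =
        insert f {g | g ∈ E ∧ G.IsNonloopAt g v} := by
      ext g
      constructor
      · rintro ⟨rfl | hg, hl⟩
        · exact Or.inl rfl
        · exact Or.inr ⟨hg, hl⟩
      · rintro (rfl | hg)
        · exact ⟨Or.inl rfl, (h.isNonloopAt_iff hxy).2 hv⟩
        · exact ⟨Or.inr hg.1, hg.2⟩
    rw [h1, Set.ncard_insert_of_notMem (fun h' => hf h'.1) (hE.subset fun g hg => hg.1)]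
    ring
  · have h1 : {g | g ∈ insert f E ∧ G.IsNonloopAt g v} = {g | g ∈ E ∧ G.IsNonloopAt g v} := by
      ext g
      constructor
      · rintro ⟨rfl | hg, hl⟩
        · exact (hv ((h.isNonloopAt_iff hxy).1 hl)).elim
        · exact ⟨hg, hl⟩
      · exact fun hg => ⟨Or.inr hg.1, hg.2⟩
    rw [h1, add_zero]

lemma IsCycle.exists_inc (h : C.IsCycle) (hv : v ∈ V(C)) : ∃ f, C.Inc f v := by
  have h2 := h.2 v hv
  rw [degree_eq_degreeOn le_rfl] at h2
  obtain ⟨f, -, hf⟩ := exists_inc_of_degreeOn_ne_zero (G := C) (E := E(C)) (v := v) (by omega)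
  exact ⟨f, hf⟩

lemma IsCycle.vertexSet_eq (h : C.IsCycle) (hCG : C ≤ G) :
    V(C) = {v | ∃ f ∈ E(C), G.Inc f v} := by
  ext v
  constructor
  · intro hv
    obtain ⟨f, hf⟩ := h.exists_inc hv
    exact ⟨f, hf.edge_mem, hf.mono hCG⟩
  · rintro ⟨f, hf, hfv⟩
    exact ((hCG.inc_congr hf).2 hfv).vertex_mem

lemma IsCycle.ext_edgeSet {C' : Graph α β} (h : C.IsCycle) (h' : C'.IsCycle) (hCG : C ≤ G)
    (hCG' : C' ≤ G) (hE : E(C) = E(C')) : C = C' :=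
  (Compatible.of_le_le hCG hCG').ext
    (by rw [h.vertexSet_eq hCG, h'.vertexSet_eq hCG', hE]) hE

lemma finite_setOf_inc (G : Graph α β) (f : β) : {v | G.Inc f v}.Finite := by
  by_cases hf : f ∈ E(G)
  · obtain ⟨x, y, h⟩ := G.exists_isLink_of_mem_edgeSet hf
    exact (Set.toFinite {x, y}).subset fun v hv => hv.eq_or_eq_of_isLink h
  · convert Set.finite_empty
    ext v
    simp [hf]

lemma IsCycle.finite_vertexSet (h : C.IsCycle) (hE : E(C).Finite) : V(C).Finite := by
  refine (hE.biUnion fun f _ => C.finite_setOf_inc f).subset fun v hv => ?_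
  obtain ⟨f, hf⟩ := h.exists_inc hv
  exact Set.mem_biUnion hf.edge_mem hf

lemma IsCycle.edgeSet_nonempty (h : C.IsCycle) : E(C).Nonempty := by
  obtain ⟨v, hv⟩ := h.1.1
  obtain ⟨f, hf⟩ := h.exists_inc hv
  exact ⟨f, hf.edge_mem⟩

end Degree

/-! ### Cycles meet cuts evenly -/

/-- The edge `f` has exactly one end in `X`. -/
def Crosses (G : Graph α β) (X : Set α) (f : β) : Prop :=
  ∃ x y, G.IsLink f x y ∧ x ∈ X ∧ y ∉ X

section Cut

variable {G H C : Graph α β} {X : Set α} {x y : α} {f : β}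

lemma IsLink.crosses_iff (h : G.IsLink f x y) :
    G.Crosses X f ↔ (x ∈ X ∧ y ∉ X) ∨ (y ∈ X ∧ x ∉ X) := by
  constructor
  · rintro ⟨a, b, hl, ha, hb⟩
    obtain ⟨rfl, rfl⟩ | ⟨rfl, rfl⟩ := hl.eq_and_eq_or_eq_and_eq h
    · exact Or.inl ⟨ha, hb⟩
    · exact Or.inr ⟨ha, hb⟩
  · rintro (h' | h')
    · exact ⟨x, y, h, h'⟩
    · exact ⟨y, x, h.symm, h'⟩

/-- Double counting of incidences between vertices in X and non-loop edges. Loops contribute evenly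
to the degree two, so each vertex meets evenly many non-loops; an edge is counted an odd number of
times exactly when it crosses. -/
lemma IsCycle.even_crosses (h : C.IsCycle) (hE : E(C).Finite) (X : Set α) :
    Even {f | f ∈ E(C) ∧ C.Crosses X f}.ncard := by
  classical
  have hV := h.finite_vertexSet hE
  set Y : Finset α := (hV.inter_of_left X).toFinset with hY
  set F : Finset β := hE.toFinset with hF
  have key := Finset.sum_card_bipartiteAbove_eq_sum_card_bipartiteBelow
    (s := Y) (t := F) (fun v f => C.IsNonloopAt f v)
  have h1 : Even (∑ v ∈ Y, (F.bipartiteAbove (fun v f => C.IsNonloopAt f v) v).card) := by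
    refine Finset.even_sum _ fun v hv => ?_
    have hv' : v ∈ V(C) := by simp [hY] at hv; exact hv.1
    have h2 := h.2 v hv'
    have h3 : (F.bipartiteAbove (fun v f => C.IsNonloopAt f v) v).card =
        {f | C.IsNonloopAt f v}.ncard := by
      rw [← Set.ncard_coe_finset]
      congr 1
      ext f
      simp only [Finset.coe_bipartiteAbove, Set.mem_ofPred_eq, hF, Set.Finite.mem_toFinset]
      exact ⟨fun h => h.2, fun h => ⟨h.edge_mem, h⟩⟩
    unfold degree at h2
    rw [h3, Nat.even_iff]
    omega
  rw [key] at h1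
  have h4 : ∀ f ∈ F, (((Y.bipartiteBelow (fun v f => C.IsNonloopAt f v) f).card : ℕ) : ZMod 2) =
      if C.Crosses X f then 1 else 0 := by
    intro f hf
    obtain ⟨a, b, hl⟩ := C.exists_isLink_of_mem_edgeSet (hE.mem_toFinset.1 hf)
    by_cases hab : a = b
    · subst hab
      have : Y.bipartiteBelow (fun v f => C.IsNonloopAt f v) f = ∅ := by
        ext v
        simp only [Finset.mem_bipartiteBelow, Finset.notMem_empty, iff_false, not_and]
        exact fun _ => IsLoopAt.not_isNonloopAt hl v
      rw [this, hl.crosses_iff]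
      simp
    · have : Y.bipartiteBelow (fun v f => C.IsNonloopAt f v) f =
          ({a, b} : Finset α).filter (· ∈ X) := by
        ext v
        simp only [Finset.mem_bipartiteBelow, hl.isNonloopAt_iff hab, Finset.mem_filter, hY,
          Set.Finite.mem_toFinset, Finset.mem_insert, Finset.mem_singleton, Set.mem_inter_iff]
        constructor
        · tauto
        · rintro ⟨rfl | rfl, hv⟩
          · exact ⟨⟨hl.left_mem, hv⟩, Or.inl rfl⟩
          · exact ⟨⟨hl.right_mem, hv⟩, Or.inr rfl⟩
      rw [this, hl.crosses_iff, Finset.filter_insert, Finset.filter_singleton]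
      by_cases ha : a ∈ X <;> by_cases hb : b ∈ X <;> simp [ha, hb, hab]
      decide
  have h5 : ((F.filter (fun f => C.Crosses X f)).card : ZMod 2) = 0 := by
    rw [Finset.card_filter, Nat.cast_sum, ← (ZMod.natCast_eq_zero_iff_even).2 h1, Nat.cast_sum]
    refine Finset.sum_congr rfl fun f hf => ?_
    rw [h4 f hf]
    split_ifs <;> simp
  rw [ZMod.natCast_eq_zero_iff_even] at h5
  convert h5
  rw [← Set.ncard_coe_finset]
  congr 1
  ext f
  simp [hF]

/-- Deleting an edge from a cycle does not disconnect it. -/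
lemma IsCycle.reach_diff (h : C.IsCycle) (hE : E(C).Finite) (hf : C.IsLink f x y) :
    C.Reach (E(C) \ {f}) x y := by
  by_contra hr
  -- If f were a bridge, it would be the only edge leaving the part of C - f that contains x: an odd
  -- cut.
  have : {g | g ∈ E(C) ∧ C.Crosses {z | C.Reach (E(C) \ {f}) x z} g} = {f} := by
    ext g
    constructor
    · rintro ⟨hg, a, b, hl, ha, hb⟩
      by_contra hgf
      exact hb (Reach.trans ha (hl.reach ⟨hg, hgf⟩))
    · rintro rfl
      exact ⟨hf.edge_mem, x, y, hf, .refl _ _ _, hr⟩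
  have h2 := h.even_crosses hE {z | C.Reach (E(C) \ {f}) x z}
  rw [this, Set.ncard_singleton] at h2
  exact absurd h2 (by decide)

end Cut

/-! ### Simple paths -/

/-- Vertex and edge sets of a path from `x` to `y`. -/
inductive PathData (G : Graph α β) : α → α → Set α → Set β → Prop
  | nil (x : α) (hx : x ∈ V(G)) : PathData G x x {x} ∅
  | cons {f : β} {x y z : α} {V : Set α} {E : Set β} (hf : G.IsLink f x y) (hx : x ∉ V)
      (h : PathData G y z V E) : PathData G x z (insert x V) (insert f E)

section Path

variable {G H C P : Graph α β} {S : Set β} {x y z v : α} {f : β} {V : Set α} {E : Set β}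

namespace PathData

lemma left_mem (h : G.PathData x y V E) : x ∈ V := by cases h <;> simp

lemma right_mem (h : G.PathData x y V E) : y ∈ V := by
  induction h with
  | nil => simp
  | cons _ _ _ ih => exact Or.inr ih

lemma subset_vertexSet (h : G.PathData x y V E) : V ⊆ V(G) := by
  induction h with
  | nil x hx => simpa
  | cons hf _ _ ih => exact Set.insert_subset hf.left_mem ih

lemma finite (h : G.PathData x y V E) : E.Finite := by
  induction h with
  | nil x hx => simp
  | cons hf _ _ ih => exact ih.insert _

lemma subset_edgeSet (h : G.PathData x y V E) : E ⊆ E(G) := by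
  induction h with
  | nil x hx => simp
  | cons hf _ _ ih => exact Set.insert_subset hf.edge_mem ih

lemma mem_of_isLink (h : G.PathData x y V E) : ∀ f ∈ E, ∀ a b, G.IsLink f a b → a ∈ V := by
  induction h with
  | nil x hx => simp
  | cons hf _ h ih =>
    rintro g (rfl | hg) a b hl
    · obtain rfl | rfl := hl.left_eq_or_eq hf
      · exact Or.inl rfl
      · exact Or.inr h.left_mem
    · exact Or.inr (ih g hg a b hl)

lemma reach (h : G.PathData x y V E) : ∀ v ∈ V, G.Reach E x v := by
  induction h with
  | nil x hx => rintro v rfl; exact .refl _ _ _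
  | cons hf _ h ih =>
    rintro v (rfl | hv)
    · exact .refl _ _ _
    · exact (hf.reach (Or.inl rfl)).trans ((ih v hv).mono (Set.subset_insert _ _))

/-- Shortcuts a walk: when a new first vertex already lies on the path, the tail from that vertex
replaces the path. -/
lemma truncate (h : G.PathData x y V E) (hv : v ∈ V) :
    ∃ V' ⊆ V, ∃ E' ⊆ E, G.PathData v y V' E' := by
  induction h with
  | nil x hx =>
    obtain rfl := hv
    exact ⟨_, subset_rfl, _, subset_rfl, .nil _ hx⟩
  | cons hf hx h ih =>
    obtain rfl | hv := hv
    · exact ⟨_, subset_rfl, _, subset_rfl, .cons hf hx h⟩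
    · obtain ⟨V', hV', E', hE', h'⟩ := ih hv
      exact ⟨V', hV'.trans (Set.subset_insert _ _), E', hE'.trans (Set.subset_insert _ _), h'⟩

lemma eq_nil (h : G.PathData x y V E) (hxy : x = y) : V = {x} ∧ E = ∅ := by
  cases h with
  | nil => exact ⟨rfl, rfl⟩
  | cons hf hx h => exact (hx (hxy ▸ h.right_mem)).elim

lemma degreeOn_eq_zero_of_notMem (h : G.PathData x y V E) (hv : v ∉ V) : G.degreeOn E v = 0 :=
  degreeOn_eq_zero fun f hf ⟨_, hl⟩ => hv (h.mem_of_isLink f hf _ _ hl)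

lemma degreeOn_eq (h : G.PathData x y V E) (hxy : x ≠ y) :
    G.degreeOn E x = 1 ∧ G.degreeOn E y = 1 ∧ ∀ v ∈ V, v ≠ x → v ≠ y → G.degreeOn E v = 2 := by
  induction h with
  | nil => exact (hxy rfl).elim
  | @cons f x y z V E hf hx h ih =>
    have hxy' : x ≠ y := fun h' => hx (h' ▸ h.left_mem)
    have hfE : f ∉ E := fun h' => hx (h.mem_of_isLink f h' _ _ hf)
    have hx0 := h.degreeOn_eq_zero_of_notMem hx
    simp only [degreeOn_insert h.finite hf hxy' hfE]
    refine ⟨by simp [hx0], ?_, ?_⟩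
    · by_cases hyz : y = z
      · subst hyz
        rw [(h.eq_nil rfl).2, degreeOn_eq_zero (by simp)]
        simp
      · rw [(ih hyz).2.1, if_neg]
        rintro (rfl | rfl)
        · exact hxy rfl
        · exact hyz rfl
    · rintro v (rfl | hv) hvx hvz
      · exact (hvx rfl).elim
      · by_cases hyz : y = z
        · subst hyz
          rw [(h.eq_nil rfl).1] at hv
          exact (hvz hv).elim
        · by_cases hvy : v = y
          · subst hvy
            rw [(ih hyz).1]
            simp
          · rw [(ih hyz).2.2 v hv hvy hvz]
            simp [hvx, hvy]

lemma isSimplePath (h : G.PathData x y V E) : (G.sub V E).IsSimplePath x y := by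
  have hV := vertexSet_sub E h.subset_vertexSet
  have hE := edgeSet_sub h.subset_edgeSet h.mem_of_isLink
  refine ⟨?_, hV.ge h.left_mem, hV.ge h.right_mem, ?_, ?_⟩
  · rw [connected_iff_reach, hV, hE]
    have hr : ∀ v ∈ V, (G.sub V E).Reach E x v := fun v hv =>
      (h.reach v hv).anti (sub_le _ _ _) hE.ge
    exact ⟨⟨x, h.left_mem⟩, fun v hv w hw => (hr v hv).symm.trans (hr w hw)⟩
  · rw [hV, hE]
    exact h.eq_nil
  · simp only [degree_eq_degreeOn (sub_le G V E), hV, hE]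
    exact h.degreeOn_eq

end PathData

lemma Reach.exists_pathData (h : G.Reach S x y) (hx : x ∈ V(G)) :
    ∃ V E, E ⊆ S ∧ G.PathData x y V E := by
  induction h using Relation.ReflTransGen.head_induction_on with
  | refl => exact ⟨_, ∅, Set.empty_subset _, .nil _ hx⟩
  | @head a b hl _ ih =>
    obtain ⟨f, hf, hl⟩ := hl
    obtain ⟨V, E, hE, hP⟩ := ih hl.right_mem
    by_cases ha : a ∈ V
    · obtain ⟨V', -, E', hE', h'⟩ := hP.truncate ha
      exact ⟨V', E', hE'.trans hE, h'⟩
    · exact ⟨_, _, Set.insert_subset hf hE, .cons hl ha hP⟩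

/-- Vertices that are joined by a walk are joined by a simple path. -/
lemma Reach.exists_isSimplePath (h : G.Reach S x y) (hx : x ∈ V(G)) :
    ∃ P ≤ G, E(P) ⊆ S ∧ P.IsSimplePath x y := by
  obtain ⟨V, E, hE, hP⟩ := h.exists_pathData hx
  exact ⟨_, sub_le G V E, (edgeSet_sub hP.subset_edgeSet hP.mem_of_isLink).trans_subset hE,
    hP.isSimplePath⟩

/-- A simple path together with an edge that connects its endpoints is a cycle. -/
lemma IsSimplePath.isCycle (hP : P.IsSimplePath x y) (hPG : P ≤ G) (hE : E(P).Finite)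
    (hf : G.IsLink f x y) (hfP : f ∉ E(P)) (hCG : C ≤ G) (hV : V(C) = V(P))
    (hEC : E(C) = insert f E(P)) : C.IsCycle := by
  obtain ⟨hc, hx, hy, h1, h2⟩ := hP
  have hPC : P ≤ C := (Compatible.of_le_le hPG hCG).le_iff.2
    ⟨hV.ge, (Set.subset_insert _ _).trans hEC.ge⟩
  refine ⟨?_, fun v hv => ?_⟩
  · rw [connected_iff_reach] at hc ⊢
    rw [hV]
    exact ⟨hc.1, fun a ha b hb => ((hc.2 a ha b hb).of_le hPC).mono
      ((Set.subset_insert _ _).trans hEC.ge)⟩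
  · rw [degree_eq_degreeOn hCG, hEC]
    rw [hV] at hv
    by_cases hxy : x = y
    · subst hxy
      obtain ⟨hV', hE'⟩ := h1 rfl
      rw [hV'] at hv
      obtain rfl := hv
      rw [hE']
      have e1 : {g | g ∈ insert f (∅ : Set β) ∧ G.IsNonloopAt g v} = ∅ := by
        refine Set.eq_empty_of_forall_notMem ?_
        rintro g ⟨rfl | hg, hl⟩
        · exact IsLoopAt.not_isNonloopAt hf _ hl
        · exact hg
      have e2 : {g | g ∈ insert f (∅ : Set β) ∧ G.IsLoopAt g v} = {f} := by
        ext g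
        constructor
        · rintro ⟨rfl | hg, hl⟩
          · rfl
          · exact hg.elim
        · rintro rfl
          exact ⟨Or.inl rfl, hf⟩
      rw [degreeOn, e1, e2]
      simp
    · obtain ⟨hx1, hy1, h3⟩ := h2 hxy
      simp only [degree_eq_degreeOn hPG] at hx1 hy1 h3
      classical
      rw [degreeOn_insert hE hf hxy hfP]
      by_cases hvx : v = x
      · subst hvx; simp [hx1]
      · by_cases hvy : v = y
        · subst hvy; simp [hy1]
        · simp [h3 v hv hvx hvy, hvx, hvy]

/-- The graph consisting of a simple path and an edge connecting its endpoints. -/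
lemma IsSimplePath.exists_insert (hP : P.IsSimplePath x y) (hPG : P ≤ G)
    (hf : G.IsLink f x y) : ∃ C ≤ G, V(C) = V(P) ∧ E(C) = insert f E(P) := by
  refine ⟨G.sub V(P) (insert f E(P)), sub_le _ _ _, vertexSet_sub _ hPG.vertexSet_mono,
    edgeSet_sub (Set.insert_subset hf.edge_mem hPG.edgeSet_mono) ?_⟩
  rintro g (rfl | hg) a b hl
  · obtain rfl | rfl := hl.left_eq_or_eq hf
    exacts [hP.2.1, hP.2.2.1]
  · exact ((hPG.isLink_iff hg).2 hl).left_mem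

/-- An edge whose ends are connected by other edges lies on a cycle. -/
lemma Reach.exists_isCycle (hE : E(G).Finite) (h : G.Reach S x y) (hf : G.IsLink f x y)
    (hfS : f ∉ S) : ∃ C ≤ G, C.IsCycle ∧ f ∈ E(C) ∧ E(C) ⊆ insert f S := by
  obtain ⟨P, hPG, hPS, hP⟩ := h.exists_isSimplePath hf.left_mem
  obtain ⟨C, hCG, hV, hEC⟩ := hP.exists_insert hPG hf
  refine ⟨C, hCG, hP.isCycle hPG (hE.subset hPG.edgeSet_mono) hf (fun h => hfS (hPS h)) hCG hV hEC,
    hEC ▸ Or.inl rfl, hEC ▸ Set.insert_subset_insert hPS⟩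

end Path

end Graph

namespace Graph

variable {α β : Type*}

/-! ### Acyclic edge sets -/

/-- No cycle of `G` has all its edges in `S`. -/
def AcyclicOn (G : Graph α β) (S : Set β) : Prop :=
  ∀ C ≤ G, C.IsCycle → ¬ E(C) ⊆ S

section Acyclic

variable {G H C C' P T : Graph α β} {S S' : Set β} {x y : α} {e f : β}

lemma AcyclicOn.mono (h : G.AcyclicOn S) (hS : S' ⊆ S) : G.AcyclicOn S' :=
  fun C hC hc hCS => h C hC hc (hCS.trans hS)

/-- A cycle through the new edge would join its ends by the remaining edges of the cycle. -/
lemma AcyclicOn.insert_of_not_reach (hE : E(G).Finite) (h : G.AcyclicOn S) (hf : G.IsLink f x y)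
    (hr : ¬ G.Reach S x y) : G.AcyclicOn (insert f S) := by
  intro C hCG hC hCS
  by_cases hfC : f ∈ E(C)
  · refine hr (((hC.reach_diff (hE.subset hCG.edgeSet_mono)
      ((hCG.isLink_iff hfC).2 hf)).of_le hCG).mono ?_)
    rintro g ⟨hg, hgf⟩
    exact (hCS hg).resolve_left hgf
  · exact h C hCG hC fun g hg => (hCS hg).resolve_left fun h => hfC (h ▸ hg)

lemma AcyclicOn.not_reach (hE : E(G).Finite) (h : G.AcyclicOn (insert f S))
    (hf : G.IsLink f x y) (hfS : f ∉ S) : ¬ G.Reach S x y := by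
  intro hr
  obtain ⟨C, hCG, hC, -, hCS⟩ := hr.exists_isCycle hE hf hfS
  exact h C hCG hC hCS

/-- A cycle that contains a cycle has no further edges. -/
lemma IsCycle.edgeSet_eq_of_le (hC : C.IsCycle) (hC' : C'.IsCycle) (h : C' ≤ C)
    (hE : E(C).Finite) : E(C') = E(C) := by
  -- Both degrees at v are two, so the smaller cycle already uses every edge of C at v;
  -- connectedness of C spreads this everywhere.
  have key : ∀ v ∈ V(C'), ∀ f, C.Inc f v → f ∈ E(C') := by
    intro v hv f hf
    have h1 := hC.2 v (h.vertexSet_mono hv)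
    have h2 := hC'.2 v hv
    rw [degree_eq_degreeOn le_rfl] at h1
    rw [degree_eq_degreeOn h] at h2
    have s1 : {f | f ∈ E(C') ∧ C.IsNonloopAt f v} ⊆ {f | f ∈ E(C) ∧ C.IsNonloopAt f v} :=
      fun g hg => ⟨h.edgeSet_mono hg.1, hg.2⟩
    have s2 : {f | f ∈ E(C') ∧ C.IsLoopAt f v} ⊆ {f | f ∈ E(C) ∧ C.IsLoopAt f v} :=
      fun g hg => ⟨h.edgeSet_mono hg.1, hg.2⟩
    have f1 : {f | f ∈ E(C) ∧ C.IsNonloopAt f v}.Finite := hE.subset fun g hg => hg.1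
    have f2 : {f | f ∈ E(C) ∧ C.IsLoopAt f v}.Finite := hE.subset fun g hg => hg.1
    have l1 := Set.ncard_le_ncard s1 f1
    have l2 := Set.ncard_le_ncard s2 f2
    unfold degreeOn at h1 h2
    have e1 := Set.eq_of_subset_of_ncard_le s1 (by omega) f1
    have e2 := Set.eq_of_subset_of_ncard_le s2 (by omega) f2
    obtain hl | hl := hf.isLoopAt_or_isNonloopAt
    · exact (e2.ge ⟨hf.edge_mem, hl⟩).1
    · exact (e1.ge ⟨hf.edge_mem, hl⟩).1
  refine h.edgeSet_mono.antisymm fun f hf => ?_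
  obtain ⟨a, b, hl⟩ := C.exists_isLink_of_mem_edgeSet hf
  obtain ⟨v, hv⟩ := hC'.1.1
  have hva := ((connected_iff_reach C).1 hC.1).2 v (h.vertexSet_mono hv) a hl.left_mem
  refine key a (hva.closed (X := V(C')) hv fun g _ c d hcd hc => ?_) f hl.inc_left
  exact ((h.isLink_iff (key c hc g hcd.inc_left)).2 hcd).right_mem

/-- Otherwise f would close up to a cycle inside C that avoids e, against the minimality of cycles.
-/
lemma IsCycle.not_reach_diff (hC : C.IsCycle) (hE : E(C).Finite) (he : e ∈ E(C))
    (hf : C.IsLink f x y) (hef : e ≠ f) : ¬ C.Reach ((E(C) \ {f}) \ {e}) x y := by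
  intro hr
  obtain ⟨C', hC'C, hC', -, hS⟩ := hr.exists_isCycle hE hf (fun h => h.1.2 rfl)
  have h := hC.edgeSet_eq_of_le hC' hC'C hE
  obtain h | h := hS (h ▸ he)
  · exact hef h
  · exact h.2 rfl

/-- All vertices of `G` are connected by edges from `S`. -/
def ConnectedOn (G : Graph α β) (S : Set β) : Prop :=
  ∀ x ∈ V(G), ∀ y ∈ V(G), G.Reach S x y

/-- A set of edges is the edge set of a Hamiltonian cycle if and only if it is nonempty, it connects
the vertices after the deletion of any edge, but not after the deletion of any two edges. -/
lemma exists_isHamiltonianCycle_iff (hE : E(G).Finite) (hS : S ⊆ E(G)) :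
    (∃ C, G.IsHamiltonianCycle C ∧ E(C) = S) ↔ S.Nonempty ∧
      (∀ f ∈ S, G.ConnectedOn (S \ {f})) ∧
      ∀ f ∈ S, ∀ g ∈ S, f ≠ g → ¬ G.ConnectedOn ((S \ {f}) \ {g}) := by
  constructor
  · rintro ⟨C, ⟨hCG, hC, hVC⟩, rfl⟩
    have hEC := hE.subset hCG.edgeSet_mono
    refine ⟨hC.edgeSet_nonempty, fun f hf x hx y hy => ?_, fun f hf g hg hfg hconn => ?_⟩
    · obtain ⟨a, b, hl⟩ := C.exists_isLink_of_mem_edgeSet hf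
      have h1 := ((connected_iff_reach C).1 hC.1).2 x (hVC ▸ hx) y (hVC ▸ hy)
      refine Reach.of_le (Reach.of_insert (f := f) (h1.mono ?_) hl (hC.reach_diff hEC hl)) hCG
      rw [Set.insert_sdiff_singleton]
      exact Set.subset_insert _ _
    · obtain ⟨a, b, hl⟩ := C.exists_isLink_of_mem_edgeSet hf
      exact hC.not_reach_diff hEC hg hl hfg.symm
        ((hconn a (hVC ▸ hl.left_mem) b (hVC ▸ hl.right_mem)).anti hCG fun h hh => hh.1.1)
  · rintro ⟨⟨f, hf⟩, h1, h2⟩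
    obtain ⟨a, b, hl⟩ := G.exists_isLink_of_mem_edgeSet (hS hf)
    obtain ⟨C, hCG, hC, hfC, hCS⟩ :=
      (h1 f hf a hl.left_mem b hl.right_mem).exists_isCycle hE hl (fun h => h.2 rfl)
    rw [Set.insert_sdiff_singleton, Set.insert_eq_of_mem hf] at hCS
    have hEC : E(C) = S := by
      refine hCS.antisymm fun g hg => ?_
      by_contra hgC
      have hfg : f ≠ g := fun h => hgC (h ▸ hfC)
      -- An edge g of S off the cycle could be deleted along with f: the rest of the cycle avoids g
      -- and bypasses f.
      refine h2 g hg f hf hfg.symm fun x hx y hy => ?_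
      refine Reach.of_insert (f := f) ((h1 g hg x hx y hy).mono ?_) hl ?_
      · rw [Set.insert_sdiff_singleton]
        exact Set.subset_insert _ _
      · refine ((hC.reach_diff (hE.subset hCG.edgeSet_mono)
          ((hCG.isLink_iff hfC).2 hl)).of_le hCG).mono ?_
        rintro h ⟨hh, hhf⟩
        exact ⟨⟨hCS hh, fun h' => hgC (h' ▸ hh)⟩, hhf⟩
    refine ⟨C, ⟨hCG, hC, hCG.vertexSet_mono.antisymm fun v hv => ?_⟩, hEC⟩
    have ha : a ∈ V(C) := ((hCG.isLink_iff hfC).2 hl).left_mem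
    refine (h1 f hf a hl.left_mem v hv).closed ha fun g hg c d hcd _ => ?_
    exact ((hCG.isLink_iff (hEC ▸ hg.1)).2 hcd).right_mem

end Acyclic

/-! ### Fundamental cycle bases -/

section Basis

variable {G H C C' P T : Graph α β} {S S' : Set β} {x y : α} {e f : β}

lemma edgeVec_apply_of_mem (hf : f ∈ E(C)) : edgeVec C f = 1 := by
  simp [edgeVec, hf]

lemma edgeVec_apply_of_notMem (hf : f ∉ E(C)) : edgeVec C f = 0 := by
  simp [edgeVec, hf]

open Classical in
/-- The sum of the entries of a vector over the edges of a cut. -/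
noncomputable def cutSum (G : Graph α β) (hE : E(G).Finite) (X : Set α) :
    (β → ZMod 2) →ₗ[ZMod 2] ZMod 2 :=
  ∑ f ∈ hE.toFinset.filter (G.Crosses X), LinearMap.proj f

lemma cutSum_edgeVec (hE : E(G).Finite) (X : Set α) (hCG : C ≤ G) (hC : C.IsCycle) :
    G.cutSum hE X (edgeVec C) = 0 := by
  classical
  have h := hC.even_crosses (hE.subset hCG.edgeSet_mono) X
  rw [← ZMod.natCast_eq_zero_iff_even] at h
  rw [← h, cutSum, LinearMap.sum_apply]
  simp only [LinearMap.proj_apply, edgeVec, Set.indicator_apply, Pi.one_apply]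
  rw [Finset.sum_ite, Finset.sum_const_zero, add_zero, Finset.sum_const, nsmul_one,
    ← Set.ncard_coe_finset]
  congr 2
  ext f
  simp only [Finset.coe_filter, Finset.mem_filter, Set.Finite.mem_toFinset, Set.mem_ofPred_eq]
  constructor
  · rintro ⟨⟨-, a, b, hl, hab⟩, hf⟩
    exact ⟨hf, a, b, (hCG.isLink_iff hf).2 hl, hab⟩
  · rintro ⟨hf, a, b, hl, hab⟩
    exact ⟨⟨hCG.edgeSet_mono hf, a, b, hl.mono hCG, hab⟩, hf⟩

/-- A vector in the cycle space that is supported on an acyclic set vanishes. -/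
lemma AcyclicOn.eq_zero (hE : E(G).Finite) (hT : G.AcyclicOn S) {v : β → ZMod 2}
    (hv : ∀ X, G.cutSum hE X v = 0) (hvS : ∀ f ∉ S, v f = 0) (hvE : ∀ f ∉ E(G), v f = 0) :
    v = 0 := by
  classical
  ext f
  by_cases hfE : f ∈ E(G)
  swap
  · exact hvE f hfE
  by_cases hfS : f ∈ S
  swap
  · exact hvS f hfS
  obtain ⟨x, y, hl⟩ := G.exists_isLink_of_mem_edgeSet hfE
  have hr : ¬ G.Reach (S \ {f}) x y := by
    refine AcyclicOn.not_reach hE (f := f) ?_ hl fun h => h.2 rfl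
    rwa [Set.insert_sdiff_singleton, Set.insert_eq_of_mem hfS]
  -- Among the edges of S only f crosses this cut, so the cut sum of v is its entry at f.
  have h := hv {z | G.Reach (S \ {f}) x z}
  rw [cutSum, LinearMap.sum_apply, Finset.sum_eq_single f] at h
  · exact h
  · intro g hg hgf
    simp only [Finset.mem_filter, Set.Finite.mem_toFinset] at hg
    refine hvS g fun hgS => ?_
    obtain ⟨-, a, b, hab, ha, hb⟩ := hg
    exact hb (Reach.trans ha (hab.reach ⟨hgS, hgf⟩))
  · intro hf
    refine absurd ?_ hf
    simp only [Finset.mem_filter, Set.Finite.mem_toFinset]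
    exact ⟨hfE, x, y, hl, .refl _ _ _, hr⟩

/-- The entries at f cancel in the difference of the two edge vectors, which leaves a vector
supported on an acyclic set and orthogonal to all cuts. This is the uniqueness of fundamental
cycles. -/
lemma AcyclicOn.edgeSet_eq (hE : E(G).Finite) (hT : G.AcyclicOn S) (hCG : C ≤ G) (hC : C.IsCycle)
    (hCG' : C' ≤ G) (hC' : C'.IsCycle) (hf : f ∈ E(C)) (hf' : f ∈ E(C'))
    (hS : E(C) ⊆ insert f S) (hS' : E(C') ⊆ insert f S) : E(C) = E(C') := by
  have h0 : edgeVec C - edgeVec C' = 0 := by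
    refine hT.eq_zero hE (fun X => ?_) (fun g hg => ?_) (fun g hg => ?_)
    · rw [map_sub, cutSum_edgeVec hE X hCG hC, cutSum_edgeVec hE X hCG' hC', sub_zero]
    · by_cases hgf : g = f
      · subst hgf
        simp [edgeVec_apply_of_mem hf, edgeVec_apply_of_mem hf']
      · have h1 : g ∉ E(C) := fun h => (hS h).elim hgf hg
        have h2 : g ∉ E(C') := fun h => (hS' h).elim hgf hg
        simp [edgeVec_apply_of_notMem h1, edgeVec_apply_of_notMem h2]
    · simp [edgeVec_apply_of_notMem fun h => hg (hCG.edgeSet_mono h),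
        edgeVec_apply_of_notMem fun h => hg (hCG'.edgeSet_mono h)]
  ext g
  have hg := congrFun (sub_eq_zero.1 h0) g
  by_cases h1 : g ∈ E(C) <;> by_cases h2 : g ∈ E(C') <;>
    simp_all [edgeVec_apply_of_mem, edgeVec_apply_of_notMem]

lemma IsSpanningTree.acyclicOn (hT : G.IsSpanningTree T) : G.AcyclicOn E(T) := fun C hC hc hCT =>
  hT.2.2.2 C ((Compatible.of_le_le hC hT.1).le_iff.2 ⟨hT.2.1 ▸ hC.vertexSet_mono, hCT⟩) hc

lemma IsSpanningTree.connectedOn (hT : G.IsSpanningTree T) : G.ConnectedOn E(T) :=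
  fun x hx y hy => (((connected_iff_reach T).1 hT.2.2.1).2 x (hT.2.1 ▸ hx) y
    (hT.2.1 ▸ hy)).of_le hT.1

lemma exists_isSpanningTree (hV : V(G).Nonempty) (hS : S ⊆ E(G)) (hac : G.AcyclicOn S)
    (hconn : G.ConnectedOn S) : ∃ T, G.IsSpanningTree T ∧ E(T) = S := by
  have hVT := vertexSet_sub (G := G) S (subset_refl V(G))
  have hET := edgeSet_sub hS fun f _ x y hl => hl.left_mem
  refine ⟨G.sub V(G) S, ⟨sub_le _ _ _, hVT, ?_, ?_⟩, hET⟩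
  · rw [connected_iff_reach, hVT, hET]
    exact ⟨hV, fun x hx y hy => (hconn x hx y hy).anti (sub_le _ _ _) hET.ge⟩
  · intro C hC hc
    exact hac C (hC.trans (sub_le _ _ _)) hc (hC.edgeSet_mono.trans hET.le)

lemma isCycle_of_mem_fundamentalCycles (hE : E(G).Finite) (hT : T ≤ G)
    (hC : C ∈ G.fundamentalCycles T) :
    C ≤ G ∧ C.IsCycle ∧ ∃ f ∉ E(T), f ∈ E(C) ∧ E(C) ⊆ insert f E(T) := by
  obtain ⟨hCG, f, x, y, hf, hl, P, hPT, hP, hV, hEC⟩ := hC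
  exact ⟨hCG, hP.isCycle (hPT.trans hT) (hE.subset (hPT.trans hT).edgeSet_mono) hl
    (fun h => hf (hPT.edgeSet_mono h)) hCG hV hEC, f, hf, hEC ▸ Or.inl rfl,
    hEC ▸ Set.insert_subset_insert hPT.edgeSet_mono⟩

/-- Allowing S to be smaller than the tree matters: with S the tree minus e, it produces a
fundamental cycle that avoids e. -/
lemma exists_mem_fundamentalCycles (hT : T ≤ G) (hV : V(T) = V(G)) (hS : S ⊆ E(T))
    (hf : f ∉ E(T)) (hl : G.IsLink f x y) (hr : G.Reach S x y) :
    ∃ C ∈ G.fundamentalCycles T, f ∈ E(C) ∧ E(C) ⊆ insert f S := by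
  obtain ⟨P, hPG, hPS, hP⟩ := hr.exists_isSimplePath hl.left_mem
  obtain ⟨C, hCG, hVC, hEC⟩ := hP.exists_insert hPG hl
  have hPT : P ≤ T :=
    (Compatible.of_le_le hPG hT).le_iff.2 ⟨hV ▸ hPG.vertexSet_mono, hPS.trans hS⟩
  exact ⟨C, ⟨hCG, f, x, y, hf, hl, P, hPT, hP, hVC, hEC⟩, hEC ▸ Or.inl rfl,
    hEC ▸ Set.insert_subset_insert hPS⟩

/-- The fundamental cycles of a spanning tree form a cycle basis. -/
lemma IsSpanningTree.isCycleBasis (hE : E(G).Finite) (hT : G.IsSpanningTree T) :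
    G.IsCycleBasis (G.fundamentalCycles T) := by
  classical
  have hfund := fun C hC => isCycle_of_mem_fundamentalCycles (C := C) hE hT.1 hC
  refine ⟨fun C hC => ⟨(hfund C hC).1, (hfund C hC).2.1⟩, ?_, ?_⟩
  -- Each fundamental cycle owns a non-tree edge that no other one contains; evaluation there
  -- isolates its coefficient.
  · choose φ hφT hφC hφS using
      fun C : G.fundamentalCycles T => (hfund C.1 C.2).2.2
    rw [LinearIndepOn, linearIndependent_iff']
    intro s g hs i hi
    have h := congrFun hs (φ i)
    rw [Finset.sum_apply, Finset.sum_eq_single i] at h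
    · simpa [edgeVec_apply_of_mem (hφC i)] using h
    · intro j _ hji
      have : φ i ∉ E(j.1) := by
        intro hmem
        have hij : φ i = φ j := (hφS j hmem).resolve_right (hφT i)
        refine hji (Subtype.ext ?_)
        refine (hfund j j.2).2.1.ext_edgeSet (hfund i i.2).2.1 (hfund j j.2).1 (hfund i i.2).1 ?_
        exact hT.acyclicOn.edgeSet_eq hE (hfund j j.2).1 (hfund j j.2).2.1 (hfund i i.2).1
          (hfund i i.2).2.1 hmem (hφC i) (hij ▸ hφS j) (hφS i)
      simp [edgeVec_apply_of_notMem this]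
    · exact fun h => (h hi).elim
  · refine le_antisymm (Submodule.span_mono (Set.image_mono
      fun C hC => ⟨(hfund C hC).1, (hfund C hC).2.1⟩)) (Submodule.span_le.2 ?_)
    rintro _ ⟨C, ⟨hCG, hC⟩, rfl⟩
    have hex : ∀ f, f ∈ E(G) \ E(T) →
        ∃ D ∈ G.fundamentalCycles T, f ∈ E(D) ∧ E(D) ⊆ insert f E(T) := by
      rintro f ⟨hfG, hfT⟩
      obtain ⟨x, y, hl⟩ := G.exists_isLink_of_mem_edgeSet hfG
      exact exists_mem_fundamentalCycles hT.1 hT.2.1 subset_rfl hfT hl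
        (hT.connectedOn x hl.left_mem y hl.right_mem)
    choose! D hD hfD hDT using hex
    set F : Finset β := (hE.subset hCG.edgeSet_mono).toFinset.filter (· ∉ E(T)) with hF
    have hFmem : ∀ f ∈ F, f ∈ E(G) \ E(T) := by
      intro f hf
      simp only [hF, Finset.mem_filter, Set.Finite.mem_toFinset] at hf
      exact ⟨hCG.edgeSet_mono hf.1, hf.2⟩
    -- Subtracting the fundamental cycles of the non-tree edges of C leaves a vector supported on
    -- the tree.
    have h0 : edgeVec C - ∑ f ∈ F, edgeVec (D f) = 0 := by
      refine hT.acyclicOn.eq_zero hE (fun X => ?_) (fun g hg => ?_) (fun g hg => ?_)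
      · rw [map_sub, map_sum, cutSum_edgeVec hE X hCG hC, Finset.sum_eq_zero, sub_zero]
        intro f hf
        have := hfund _ (hD f (hFmem f hf))
        exact cutSum_edgeVec hE X this.1 this.2.1
      · have hzero : ∀ f ∈ F, f ≠ g → edgeVec (D f) g = 0 := fun f hf hfg =>
          edgeVec_apply_of_notMem fun h => (hDT f (hFmem f hf) h).elim (fun h => hfg h.symm) hg
        rw [Pi.sub_apply, Finset.sum_apply, sub_eq_zero]
        by_cases hgC : g ∈ E(C)
        · have hgF : g ∈ F := by simp [hF, hgC, hg]
          rw [Finset.sum_eq_single_of_mem g hgF hzero, edgeVec_apply_of_mem hgC,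
            edgeVec_apply_of_mem (hfD g (hFmem g hgF))]
        · rw [edgeVec_apply_of_notMem hgC, Finset.sum_eq_zero]
          intro f hf
          refine hzero f hf ?_
          rintro rfl
          simp [hF, hgC] at hf
      · rw [Pi.sub_apply, Finset.sum_apply,
          edgeVec_apply_of_notMem fun h => hg (hCG.edgeSet_mono h), Finset.sum_eq_zero, sub_zero]
        intro f hf
        exact edgeVec_apply_of_notMem fun h =>
          hg ((hfund _ (hD f (hFmem f hf))).1.edgeSet_mono h)
    rw [SetLike.mem_coe, sub_eq_zero.1 h0]
    exact Submodule.sum_mem _ fun f hf =>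
      Submodule.subset_span ⟨_, hD f (hFmem f hf), rfl⟩

end Basis

/-! ### Rooted fundamental cycle bases and Hamiltonian cycles of an abstract dual -/

/-- `H` is a dual of `G`: a set of edges connects `H` if and only if its complement is acyclic
in `G`. -/
structure IsDual {γ : Type*} (G : Graph α β) (H : Graph γ β) : Prop where
  edgeSet_eq : E(H) = E(G)
  connectedOn_iff : ∀ S ⊆ E(G), H.ConnectedOn S ↔ G.AcyclicOn (E(G) \ S)

section Dual

variable {γ : Type*} {G T : Graph α β} {H : Graph γ β} {S : Set β} {e : β}

/-- Deleting edges of S in the dual amounts to adding them to the complement of S in the primal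
graph. -/
lemma IsDual.exists_isHamiltonianCycle_iff (hE : E(G).Finite) (hD : IsDual G H) (hS : S ⊆ E(G)) :
    (∃ C, H.IsHamiltonianCycle C ∧ E(C) = S) ↔ S.Nonempty ∧
      (∀ f ∈ S, G.AcyclicOn (insert f (E(G) \ S))) ∧
      ∀ f ∈ S, ∀ g ∈ S, f ≠ g → ¬ G.AcyclicOn (insert g (insert f (E(G) \ S))) := by
  rw [Graph.exists_isHamiltonianCycle_iff (hD.edgeSet_eq ▸ hE) (hD.edgeSet_eq ▸ hS)]
  have key : ∀ A ⊆ S, H.ConnectedOn (S \ A) ↔ G.AcyclicOn (A ∪ (E(G) \ S)) := by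
    intro A hA
    rw [hD.connectedOn_iff _ (Set.sdiff_subset.trans hS)]
    congr! 1
    ext f
    have := @hS f
    have := @hA f
    simp only [Set.mem_sdiff, Set.mem_union]
    tauto
  refine and_congr_right fun _ => and_congr (forall₂_congr fun f hf => ?_)
    (forall₂_congr fun f hf => forall₃_congr fun g hg _ => not_congr ?_)
  · rw [key {f} (by simpa), Set.singleton_union]
  · rw [Set.sdiff_sdiff, key _ (by simp [Set.insert_subset_iff, hf, hg])]
    congr! 1
    ext
    simp only [Set.mem_union, Set.mem_singleton_iff, Set.mem_insert_iff]
    tauto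

/-- Exchange of tree edges: if an edge `f` connects the two parts of `T - e`, then `T - e + f`
is connected. -/
lemma ConnectedOn.exchange {a b c d : α} {f : β} (h : G.ConnectedOn S) (he : G.IsLink e a b)
    (hf : G.IsLink f c d) (hr : ¬ G.Reach (S \ {e}) c d) :
    G.ConnectedOn (insert f (S \ {e})) := by
  have h1 : ∀ x ∈ V(G), G.Reach (S \ {e}) a x ∨ G.Reach (S \ {e}) b x := fun x hx =>
    (h a he.left_mem x hx).left_or_right he
  have hsub : S \ {e} ⊆ insert f (S \ {e}) := Set.subset_insert _ _
  have hcd : G.Reach (insert f (S \ {e})) c d := hf.reach (Or.inl rfl)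
  have hab : G.Reach (insert f (S \ {e})) a b := by
    obtain hc | hc := h1 c hf.left_mem <;> obtain hd | hd := h1 d hf.right_mem
    · exact (hr (hc.symm.trans hd)).elim
    · exact ((hc.mono hsub).trans hcd).trans (hd.mono hsub).symm
    · exact ((hd.mono hsub).trans hcd.symm).trans (hc.mono hsub).symm
    · exact (hr (hc.symm.trans hd)).elim
  have h2 : ∀ x ∈ V(G), G.Reach (insert f (S \ {e})) a x := fun x hx =>
    (h1 x hx).elim (·.mono hsub) fun h => hab.trans (h.mono hsub)
  exact fun x hx y hy => (h2 x hx).symm.trans (h2 y hy)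

lemma IsDual.isRootedAt_iff (hE : E(G).Finite) (hD : IsDual G H) (hT : G.IsSpanningTree T)
    (he : e ∈ E(T)) : IsRootedAt (G.fundamentalCycles T) e ↔
      ∃ C, H.IsHamiltonianCycle C ∧ E(C) = (E(G) \ E(T)) ∪ {e} := by
  have hTG := hT.1.edgeSet_mono
  rw [hD.exists_isHamiltonianCycle_iff hE
    (Set.union_subset Set.sdiff_subset (Set.singleton_subset_iff.2 (hTG he)))]
  have hcompl : E(G) \ ((E(G) \ E(T)) ∪ {e}) = E(T) \ {e} := by
    ext f
    have := @hTG f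
    simp only [Set.mem_sdiff, Set.mem_union, Set.mem_singleton_iff]
    tauto
  have hins : insert e (E(T) \ {e}) = E(T) := by
    rw [Set.insert_sdiff_singleton, Set.insert_eq_of_mem he]
  rw [hcompl]
  constructor
  · intro hroot
    -- A connection within T - e would give a fundamental cycle of f that misses the root.
    have hnr : ∀ f ∈ E(G) \ E(T), ∀ c d, G.IsLink f c d → ¬ G.Reach (E(T) \ {e}) c d := by
      intro f hf c d hl hr
      obtain ⟨C, hC, hfC, hCS⟩ :=
        exists_mem_fundamentalCycles hT.1 hT.2.1 Set.sdiff_subset hf.2 hl hr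
      obtain h | h := hCS (hroot C hC)
      · exact hf.2 (h ▸ he)
      · exact h.2 rfl
    refine ⟨⟨e, Or.inr rfl⟩, ?_, ?_⟩
    · rintro f (hf | rfl)
      · obtain ⟨c, d, hl⟩ := G.exists_isLink_of_mem_edgeSet hf.1
        exact (hT.acyclicOn.mono Set.sdiff_subset).insert_of_not_reach hE hl (hnr f hf c d hl)
      · rw [hins]
        exact hT.acyclicOn
    · intro f hf g hg hfg hac
      -- T - e + f connects all vertices, so any further edge g closes a cycle.
      have hconn : G.ConnectedOn (insert f (E(T) \ {e})) := by
        rcases hf with hf | rfl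
        · obtain ⟨a, b, hab⟩ := G.exists_isLink_of_mem_edgeSet (hTG he)
          obtain ⟨c, d, hl⟩ := G.exists_isLink_of_mem_edgeSet hf.1
          exact hT.connectedOn.exchange hab hl (hnr f hf c d hl)
        · rw [hins]
          exact hT.connectedOn
      have hgG : g ∈ E(G) := hg.elim (·.1) (fun h => h ▸ hTG he)
      obtain ⟨c, d, hl⟩ := G.exists_isLink_of_mem_edgeSet hgG
      refine hac.not_reach hE hl ?_ (hconn c hl.left_mem d hl.right_mem)
      rintro (h | h)
      · exact hfg h.symm
      · exact hg.elim (fun h' => h'.2 h.1) h.2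
  · rintro ⟨-, h1, -⟩ C hC
    by_contra heC
    obtain ⟨hCG, hc, f, hfT, hfC, hCS⟩ := isCycle_of_mem_fundamentalCycles hE hT.1 hC
    refine h1 f (Or.inl ⟨hCG.edgeSet_mono hfC, hfT⟩) C hCG hc fun g hg => ?_
    obtain rfl | h := hCS hg
    · exact Or.inl rfl
    · exact Or.inr ⟨h, fun h' => heC (h' ▸ hg)⟩

lemma IsDual.exists_isRootedFundamentalCycleBasis_iff (hE : E(G).Finite) (hG : G.Connected)
    (hD : IsDual G H) (he : e ∈ E(G)) (hloop : ∀ v, ¬ G.IsLoopAt e v) :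
    (∃ B, G.IsRootedFundamentalCycleBasis e B) ↔
      ∃ C, H.IsHamiltonianCycle C ∧ e ∈ E(C) := by
  constructor
  · rintro ⟨_, -, ⟨T, hT, rfl⟩, hroot⟩
    by_cases heT : e ∈ E(T)
    · obtain ⟨C, hC, hEC⟩ := (hD.isRootedAt_iff hE hT heT).1 hroot
      exact ⟨C, hC, hEC ▸ Or.inr rfl⟩
    -- With e outside the tree, a fundamental cycle can contain e only if it is the one of e itself.
    have hcompl : E(G) = insert e E(T) := by
      refine Set.Subset.antisymm (fun f hf => ?_) (Set.insert_subset he hT.1.edgeSet_mono)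
      by_contra hfe
      have hfT : f ∉ E(T) := fun h => hfe (Or.inr h)
      obtain ⟨x, y, hl⟩ := G.exists_isLink_of_mem_edgeSet hf
      obtain ⟨C, hC, hfC, hCS⟩ := exists_mem_fundamentalCycles hT.1 hT.2.1 subset_rfl hfT hl
        (hT.connectedOn x hl.left_mem y hl.right_mem)
      obtain h | h := hCS (hroot C hC)
      · exact hfe (Or.inl h.symm)
      · exact heT h
    obtain ⟨x, y, hl⟩ := G.exists_isLink_of_mem_edgeSet he
    have hxy : x ≠ y := by
      rintro rfl
      exact hloop x hl
    obtain ⟨C, hCG, hC, heC, hCS⟩ :=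
      (hT.connectedOn x hl.left_mem y hl.right_mem).exists_isCycle hE hl heT
    have hr := hC.reach_diff (hE.subset hCG.edgeSet_mono) ((hCG.isLink_iff heC).2 hl)
    -- Here the assumption that e is not a loop enters: the unique cycle has another edge h, and {e,
    -- h} will be the dual Hamiltonian cycle.
    obtain ⟨h, hhC, hhe⟩ : ∃ h ∈ E(C), h ≠ e := by
      by_contra! hall
      refine hxy (hr.closed (X := {x}) rfl fun g hg => ?_).symm
      exact (hg.2 (hall g hg.1)).elim
    have hhT : h ∈ E(T) := (hCS hhC).resolve_left hhe
    have hhG := hT.1.edgeSet_mono hhT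
    have hE2 : E(G) \ {e, h} = E(T) \ {h} := by
      ext g
      simp only [hcompl, Set.mem_sdiff, Set.mem_insert_iff, Set.mem_singleton_iff]
      constructor
      · tauto
      · rintro ⟨h1, h2⟩
        exact ⟨Or.inr h1, fun h3 => h3.elim (fun h4 => heT (h4 ▸ h1)) h2⟩
    have hins : insert h (E(T) \ {h}) = E(T) := by
      rw [Set.insert_sdiff_singleton, Set.insert_eq_of_mem hhT]
    have hnac : ¬ G.AcyclicOn (insert e E(T)) := fun hac => hac C hCG hC hCS
    obtain ⟨D, hD', hED⟩ := (hD.exists_isHamiltonianCycle_iff hE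
      (S := {e, h}) (by simp [Set.insert_subset_iff, he, hhG])).2 ⟨⟨e, Or.inl rfl⟩, by
        rintro f (rfl | rfl)
        · rw [hE2]
          intro C' hCG' hC' hCS'
          by_cases hfC' : f ∈ E(C')
          · have heq := hT.acyclicOn.edgeSet_eq hE hCG hC hCG' hC' heC hfC' hCS
              (hCS'.trans (Set.insert_subset_insert Set.sdiff_subset))
            obtain h3 | h3 := hCS' (heq ▸ hhC)
            · exact hhe h3
            · exact h3.2 rfl
          · exact hT.acyclicOn C' hCG' hC' fun g hg =>
              ((hCS' hg).resolve_left fun h3 => hfC' (h3 ▸ hg)).1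
        · rw [hE2, hins]
          exact hT.acyclicOn, by
        rintro f (rfl | rfl) g (rfl | rfl) hfg
        · exact (hfg rfl).elim
        · rwa [hE2, Set.insert_comm, hins]
        · rwa [hE2, hins]
        · exact (hfg rfl).elim⟩
    exact ⟨D, hD', hED ▸ Or.inl rfl⟩
  · rintro ⟨C, hC, heC⟩
    have hS : E(C) ⊆ E(G) := hD.edgeSet_eq ▸ hC.1.edgeSet_mono
    obtain ⟨-, h1, h2⟩ := (hD.exists_isHamiltonianCycle_iff hE hS).1 ⟨C, hC, rfl⟩
    -- The set is a maximal acyclic one: an edge between two of its components could be added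
    -- without creating a cycle, contrary to `h2`.
    have hconn : G.ConnectedOn (insert e (E(G) \ E(C))) := by
      intro x hx y hy
      refine (((connected_iff_reach G).1 hG).2 x hx y hy).lift fun f hf c d hl => ?_
      by_cases hfT : f ∈ insert e (E(G) \ E(C))
      · exact hl.reach hfT
      · by_contra hr
        have hfC : f ∈ E(C) := by
          by_contra h
          exact hfT (Or.inr ⟨hf, h⟩)
        exact h2 e heC f hfC (fun h => hfT (Or.inl h.symm))
          ((h1 e heC).insert_of_not_reach hE hl hr)
    obtain ⟨T, hT, hET⟩ := exists_isSpanningTree hG.1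
      (Set.insert_subset he Set.sdiff_subset) (h1 e heC) hconn
    refine ⟨_, hT.isCycleBasis hE, ⟨T, hT, rfl⟩,
      (hD.isRootedAt_iff hE hT (hET ▸ Or.inl rfl)).2 ⟨C, hC, ?_⟩⟩
    ext f
    have := @hS f
    have h3 : f = e → f ∈ E(C) := fun h => h ▸ heC
    simp only [hET, Set.mem_union, Set.mem_sdiff, Set.mem_insert_iff, Set.mem_singleton_iff]
    tauto

end Dual

end Graph

/-! ### Plane topology by continuous logarithms. -/

open scoped unitInterval

/-! ### Continuous logarithms -/

namespace PlaneSeparation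

section Log

variable {X : Type*} [TopologicalSpace X] {K L : Set X} {u v : X → ℂ}

/-- `u` has a continuous logarithm on `K`. -/
def HasLog (K : Set X) (u : X → ℂ) : Prop :=
  ∃ g : X → ℂ, ContinuousOn g K ∧ ∀ z ∈ K, Complex.exp (g z) = u z

lemma HasLog.mono (h : HasLog K u) (hL : L ⊆ K) : HasLog L u :=
  let ⟨g, hg, hgu⟩ := h
  ⟨g, hg.mono hL, fun z hz => hgu z (hL hz)⟩

lemma HasLog.congr (h : HasLog K u) (huv : ∀ z ∈ K, u z = v z) : HasLog K v :=
  let ⟨g, hg, hgu⟩ := h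
  ⟨g, hg, fun z hz => (hgu z hz).trans (huv z hz)⟩

lemma HasLog.mul (hu : HasLog K u) (hv : HasLog K v) : HasLog K fun z => u z * v z := by
  obtain ⟨g, hg, hgu⟩ := hu
  obtain ⟨h, hh, hhv⟩ := hv
  exact ⟨fun z => g z + h z, hg.add hh, fun z hz => by rw [Complex.exp_add, hgu z hz, hhv z hz]⟩

lemma HasLog.inv (hu : HasLog K u) : HasLog K fun z => (u z)⁻¹ := by
  obtain ⟨g, hg, hgu⟩ := hu
  exact ⟨fun z => -g z, hg.neg, fun z hz => by rw [Complex.exp_neg, hgu z hz]⟩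

/-- The fibres of the covering map exp are discrete. -/
lemma eq_of_exp_eq_const {s : Set X} (hs : IsPreconnected s) {k : X → ℂ} (hk : ContinuousOn k s)
    {c : ℂ} (hc : ∀ x ∈ s, Complex.exp (k x) = c) {x y : X} (hx : x ∈ s) (hy : y ∈ s) :
    k x = k y := by
  have hc0 : c ≠ 0 := hc x hx ▸ Complex.exp_ne_zero _
  have := (Complex.isCoveringMap_exp ⟨c, hc0⟩).discreteTopology_fiber
  refine hs.constant_of_mapsTo
    (T := (fun z : ℂ ↦ (⟨_, z.exp_ne_zero⟩ : {z : ℂ // z ≠ 0})) ⁻¹' {⟨c, hc0⟩})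
    ⟨this⟩ hk (fun z hz => ?_) hx hy
  exact Subtype.ext (hc z hz)

/-- The endpoint of a homotopy that starts at the constant function one has a logarithm. -/
lemma exists_log_of_homotopy (H : C(I × X, ℂ)) (h0 : ∀ p, H p ≠ 0) (h1 : ∀ x, H (0, x) = 1) :
    ∃ g : C(X, ℂ), ∀ x, Complex.exp (g x) = H (1, x) := by
  let H' : C(I × X, {z : ℂ // z ≠ 0}) := ⟨fun p => ⟨H p, h0 p⟩, by fun_prop⟩
  have hH : ∀ a, H' (0, a) = (⟨_, Complex.exp_ne_zero ((ContinuousMap.const X (0 : ℂ)) a)⟩ :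
      {z : ℂ // z ≠ 0}) := fun a => Subtype.ext (by simp [H', h1])
  let G := Complex.isCoveringMap_exp.liftHomotopy H' (ContinuousMap.const X 0) hH
  refine ⟨G.comp ((ContinuousMap.const X 1).prodMk (ContinuousMap.id X)), fun x => ?_⟩
  exact congrArg Subtype.val
    (congrFun (Complex.isCoveringMap_exp.liftHomotopy_lifts H' (ContinuousMap.const X 0) hH) (1, x))

/-- A nonvanishing function on a contractible space has a logarithm. -/
lemma exists_log_of_contraction (c : C(I × X, X)) (x₀ : X) (h0 : ∀ x, c (0, x) = x₀)
    (h1 : ∀ x, c (1, x) = x) (u : C(X, ℂ)) (hu : ∀ x, u x ≠ 0) :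
    ∃ g : C(X, ℂ), ∀ x, Complex.exp (g x) = u x := by
  obtain ⟨g, hg⟩ := exists_log_of_homotopy
    (⟨fun p => u (c p) / u x₀, by fun_prop (disch := exact fun _ => hu _)⟩ : C(I × X, ℂ))
    (fun p => div_ne_zero (hu _) (hu _)) (fun x => by simp [h0, hu])
  refine ⟨g + ContinuousMap.const X (Complex.log (u x₀)), fun x => ?_⟩
  have := hg x
  simp only [ContinuousMap.coe_mk, h1] at this
  simp only [ContinuousMap.add_apply, ContinuousMap.const_apply]
  rw [Complex.exp_add, this, Complex.exp_log (hu _), div_mul_cancel₀ _ (hu _)]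

lemma exists_log_unitInterval (u : C(I, ℂ)) (hu : ∀ t, u t ≠ 0) :
    ∃ g : C(I, ℂ), ∀ t, Complex.exp (g t) = u t :=
  exists_log_of_contraction ⟨fun p => p.1 * p.2, by fun_prop⟩ 0 (by simp) (by simp) u hu

lemma exists_log_complex (u : C(ℂ, ℂ)) (hu : ∀ z, u z ≠ 0) :
    ∃ g : C(ℂ, ℂ), ∀ z, Complex.exp (g z) = u z :=
  exists_log_of_contraction ⟨fun p => ((p.1 : ℝ) : ℂ) * p.2, by fun_prop⟩ 0 (by simp) (by simp) u hu

lemma HasLog.union (hK : IsClosed K) (hL : IsClosed L) {g h : X → ℂ} (hg : ContinuousOn g K)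
    (hh : ContinuousOn h L) (hgu : ∀ z ∈ K, Complex.exp (g z) = u z)
    (hhu : ∀ z ∈ L, Complex.exp (h z) = u z) (hgh : ∀ z ∈ K, z ∈ L → g z = h z) :
    HasLog (K ∪ L) u := by
  classical
  refine ⟨fun z => if z ∈ K then g z else h z, ContinuousOn.union_of_isClosed ?_ ?_ hK hL, ?_⟩
  · exact hg.congr fun z hz => if_pos hz
  · refine hh.congr fun z hz => ?_
    by_cases hzK : z ∈ K
    · simp only [if_pos hzK, hgh z hzK hz]
    · simp only [if_neg hzK]
  · intro z hz
    by_cases hzK : z ∈ K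
    · simp only [if_pos hzK, hgu z hzK]
    · simp only [if_neg hzK, hhu z (hz.resolve_left hzK)]

/-- A function on a compact space that is constant on the fibres of `γ` factors through `γ`. -/
lemma exists_continuousOn_range [CompactSpace X] (γ : C(X, ℂ)) (h : C(X, ℂ))
    (hγ : ∀ s t, γ s = γ t → h s = h t) :
    ∃ g : ℂ → ℂ, ContinuousOn g (Set.range γ) ∧ ∀ s, g (γ s) = h s := by
  classical
  have hq : Topology.IsQuotientMap (Set.rangeFactorization γ) :=
    (Continuous.isClosedMap (by fun_prop)).isQuotientMap (by fun_prop)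
      Set.rangeFactorization_surjective
  let g : ℂ → ℂ := fun z => if hz : z ∈ Set.range γ then h hz.choose else 0
  have hg : ∀ s, g (γ s) = h s := by
    intro s
    have hs : γ s ∈ Set.range γ := ⟨s, rfl⟩
    simp only [g, dif_pos hs]
    exact hγ _ _ hs.choose_spec
  refine ⟨g, ?_, hg⟩
  rw [continuousOn_iff_continuous_domRestrict, hq.continuous_iff]
  convert h.continuous using 1
  exact funext hg

end Log

/-- A logarithm on a closed set extends over the image of a path along which it can be continued
consistently. -/
lemma HasLog.attach {K : Set ℂ} (hK : IsClosed K) {u g : ℂ → ℂ} (hg : ContinuousOn g K)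
    (hgu : ∀ z ∈ K, Complex.exp (g z) = u z) (γ h : C(I, ℂ))
    (hh : ∀ t, Complex.exp (h t) = u (γ t)) (hγ : ∀ s t, γ s = γ t → h s = h t)
    (hgh : ∀ t, γ t ∈ K → g (γ t) = h t) : HasLog (K ∪ Set.range γ) u := by
  obtain ⟨k, hk, hkh⟩ := exists_continuousOn_range γ h hγ
  refine HasLog.union hK (isCompact_range γ.continuous).isClosed hg hk hgu ?_ ?_
  · rintro _ ⟨t, rfl⟩
    rw [hkh, hh]
  · rintro _ hz ⟨t, rfl⟩
    rw [hkh, hgh t hz]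

/-- A logarithm of `u` along a path, with prescribed initial value. -/
lemma exists_log_path {K : Set ℂ} {u : ℂ → ℂ} (γ : C(I, ℂ)) (hK : Set.range γ ⊆ K)
    (hu : ContinuousOn u K) (hu0 : ∀ z ∈ K, u z ≠ 0) {c : ℂ} (hc : Complex.exp c = u (γ 0)) :
    ∃ h : C(I, ℂ), h 0 = c ∧ ∀ t, Complex.exp (h t) = u (γ t) := by
  obtain ⟨h, hh⟩ := exists_log_unitInterval
    ⟨fun t => u (γ t), hu.comp_continuous γ.continuous fun t => hK ⟨t, rfl⟩⟩
    fun t => hu0 _ (hK ⟨t, rfl⟩)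
  refine ⟨h + ContinuousMap.const I (c - h 0), by simp, fun t => ?_⟩
  have h0 := hh 0
  have ht := hh t
  simp only [ContinuousMap.coe_mk] at h0 ht
  simp only [ContinuousMap.add_apply, ContinuousMap.const_apply]
  rw [Complex.exp_add, Complex.exp_sub, hc, h0, ht, div_self (hu0 _ (hK ⟨0, rfl⟩)), mul_one]

/-- A logarithm extends over an arc that meets the set in one endpoint only. -/
lemma HasLog.attach_hanging {K : Set ℂ} (hK : IsClosed K) {u : ℂ → ℂ} (hu : HasLog K u)
    (γ : C(I, ℂ)) (hγ : Function.Injective γ) (h0 : γ 0 ∈ K) (h1 : ∀ t, γ t ∈ K → t = 0)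
    (huc : ContinuousOn u (K ∪ Set.range γ)) (hu0 : ∀ z ∈ K ∪ Set.range γ, u z ≠ 0) :
    HasLog (K ∪ Set.range γ) u := by
  obtain ⟨g, hg, hgu⟩ := hu
  obtain ⟨h, hh0, hh⟩ := exists_log_path γ Set.subset_union_right huc hu0 (hgu _ h0)
  refine HasLog.attach hK hg hgu γ h hh (fun s t hst => by rw [hγ hst]) fun t ht => ?_
  rw [h1 t ht, hh0]

/-! ### Eilenberg's criterion -/

section Eilenberg

variable {K : Set ℂ} {p q r : ℂ}

/-- Along t ↦ c + R exp(it), the logarithm minus imt has constant exponential and is therefore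
constant. Comparing t = 0 with t = 2π gives 2πim = 0. -/
lemma hasLog_sphere {c : ℂ} {R : ℝ} (hR : 0 < R) {m : ℤ}
    (h : HasLog (Metric.sphere c R) fun z => (z - c) ^ m) : m = 0 := by
  obtain ⟨g, hg, hgu⟩ := h
  have hmem : ∀ t : ℝ, circleMap c R t ∈ Metric.sphere c R := circleMap_mem_sphere c hR.le
  have hk : Continuous fun t : ℝ => g (circleMap c R t) - m * (t * Complex.I) :=
    (hg.comp_continuous (continuous_circleMap c R) hmem).sub (by fun_prop)
  have hR0 : (R : ℂ) ≠ 0 := by exact_mod_cast hR.ne'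
  have hexp : ∀ t ∈ (Set.univ : Set ℝ),
      Complex.exp (g (circleMap c R t) - m * (t * Complex.I)) = (R : ℂ) ^ m := by
    intro t _
    rw [Complex.exp_sub, hgu _ (hmem t)]
    beta_reduce
    rw [circleMap_sub_center, circleMap, zero_add, mul_zpow,
      ← Complex.exp_int_mul, mul_div_assoc, div_self (Complex.exp_ne_zero _), mul_one]
  have h := eq_of_exp_eq_const isPreconnected_univ hk.continuousOn hexp (Set.mem_univ 0)
    (Set.mem_univ (2 * Real.pi))
  have hp : circleMap c R (2 * Real.pi) = circleMap c R 0 := by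
    simp [circleMap]
  rw [hp, sub_right_inj] at h
  have hpi := Real.pi_ne_zero
  simpa [Complex.I_ne_zero, hpi] using h

lemma sub_ne_zero_of_mem (hp : p ∉ K) {z : ℂ} (hz : z ∈ K) : z - p ≠ 0 :=
  sub_ne_zero.2 fun h => hp (h ▸ hz)

/-- Points in the same component of the complement are not separated by logarithms. -/
lemma hasLog_of_mem_component (hK : IsClosed K) (hp : p ∉ K)
    (hq : q ∈ connectedComponentIn Kᶜ p) : HasLog K fun z => (z - p) / (z - q) := by
  refine isPreconnected_connectedComponentIn.induction₂ (s := connectedComponentIn Kᶜ p)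
    (fun p q => HasLog K fun z => (z - p) / (z - q)) (fun p hp => ?_) ?_ ?_
    (mem_connectedComponentIn hp) hq
  · have hpK : p ∉ K := connectedComponentIn_subset _ _ hp
    obtain ⟨ε, hε, hball⟩ := Metric.isOpen_iff.1 hK.isOpen_compl p hpK
    filter_upwards [mem_nhdsWithin_of_mem_nhds (Metric.ball_mem_nhds p hε)] with q hq
    -- For q closer to p than K is, the quotient stays in the unit disc about 1, where the principal
    -- branch is continuous.
    have : HasLog K fun z => (z - q) / (z - p) := by
      refine ⟨fun z => Complex.log ((z - q) / (z - p)), ?_, fun z hz => ?_⟩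
      · refine ContinuousOn.clog (ContinuousOn.div (by fun_prop) (by fun_prop)
          fun z hz => sub_ne_zero_of_mem hpK hz) fun z hz => ?_
        have hz0 := sub_ne_zero_of_mem hpK hz
        have hzp : ε ≤ ‖z - p‖ := by
          by_contra! h
          exact hball (mem_ball_iff_norm.2 h) hz
        have hlt : ‖(q - p) / (z - p)‖ < 1 := by
          rw [norm_div, div_lt_one (norm_pos_iff.2 hz0)]
          exact (mem_ball_iff_norm.1 hq).trans_le hzp
        have heq : (z - q) / (z - p) = 1 + -((q - p) / (z - p)) := by
          field_simp
          ring
        rw [heq]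
        exact Complex.mem_slitPlane_of_norm_lt_one (by rwa [norm_neg])
      · refine Complex.exp_log (div_ne_zero ?_ (sub_ne_zero_of_mem hpK hz))
        exact sub_ne_zero.2 fun h => hball (h ▸ hq) hz
    exact this.inv.congr fun z _ => inv_div _ _
  · intro a b c _ hb _ hab hbc
    refine (hab.mul hbc).congr fun z hz => ?_
    exact div_mul_div_cancel₀ (sub_ne_zero_of_mem (connectedComponentIn_subset _ _ hb) hz)
  · intro a b _ _ hab
    exact hab.inv.congr fun z _ => inv_div _ _

/-- Components of an open set are open, so a limit point off K belongs to the same component. -/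
lemma closure_component_subset (hK : IsClosed K) (p : ℂ) :
    closure (connectedComponentIn Kᶜ p) ⊆ connectedComponentIn Kᶜ p ∪ K := by
  intro z hz
  by_contra h
  rw [Set.mem_union, not_or] at h
  have hz' : z ∈ connectedComponentIn Kᶜ z := mem_connectedComponentIn h.2
  obtain ⟨w, hw, hwp⟩ := mem_closure_iff.1 hz _ hK.isOpen_compl.connectedComponentIn hz'
  exact h.1 ((connectedComponentIn_eq hwp).trans (connectedComponentIn_eq hw).symm ▸ hz')

lemma compl_component_isClosed (hK : IsClosed K) (p : ℂ) :
    IsClosed (connectedComponentIn Kᶜ p)ᶜ :=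
  hK.isOpen_compl.connectedComponentIn.isClosed_compl

/-- The winding number of a function with a logarithm around a bounded component vanishes. -/
lemma eq_zero_of_hasLog (hK : IsClosed K) (hp : p ∉ K)
    (hb : Bornology.IsBounded (connectedComponentIn Kᶜ p)) {w : ℂ → ℂ}
    (hw : ContinuousOn w (connectedComponentIn Kᶜ p ∪ K))
    (hw0 : ∀ z ∈ connectedComponentIn Kᶜ p ∪ K, w z ≠ 0) {m : ℤ}
    (h : HasLog K fun z => (z - p) ^ m * w z) : m = 0 := by
  classical
  obtain ⟨g, hg, hgu⟩ := h
  set U := connectedComponentIn Kᶜ p with hU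
  have hpU : p ∈ U := mem_connectedComponentIn hp
  have hcl := closure_component_subset hK p
  obtain ⟨G, hG⟩ := ContinuousMap.exists_restrict_eq hK
    ⟨K.domRestrict g, continuousOn_iff_continuous_domRestrict.1 hg⟩
  have hGg : ∀ z ∈ K, G z = g z := fun z hz => congrArg (fun f => f ⟨z, hz⟩) hG
  -- With the logarithm extended by Tietze's theorem, the two formulas agree on the boundary of U.
  -- So F is continuous and nonvanishing on the plane and has a global logarithm; on a large circle
  -- about p it is (z - p) ^ m.
  let F : ℂ → ℂ := fun z => if z ∈ U then Complex.exp (G z) / w z else (z - p) ^ m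
  have hFU : ContinuousOn F (closure U) := by
    have h1 : ContinuousOn (fun z => Complex.exp (G z) / w z) (closure U) :=
      ContinuousOn.div (by fun_prop) (hw.mono hcl) fun z hz => hw0 z (hcl hz)
    refine h1.congr fun z hz => ?_
    by_cases hzU : z ∈ U
    · simp only [F, if_pos hzU]
    · have hzK : z ∈ K := (hcl hz).resolve_left hzU
      simp only [F, if_neg hzU]
      rw [hGg z hzK, hgu z hzK, mul_div_cancel_right₀ _ (hw0 z (hcl hz))]
  have hFc : ContinuousOn F Uᶜ := by
    have h1 : ContinuousOn (fun z => (z - p) ^ m) Uᶜ :=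
      ContinuousOn.zpow₀ (by fun_prop) m fun z hz =>
        Or.inl (sub_ne_zero.2 fun h => hz (h ▸ hpU))
    exact h1.congr fun z hz => if_neg hz
  have hF : Continuous F := by
    rw [← continuousOn_univ]
    refine (hFU.union_of_isClosed hFc isClosed_closure (compl_component_isClosed hK p)).mono ?_
    intro z _
    by_cases hz : z ∈ U
    · exact Or.inl (subset_closure hz)
    · exact Or.inr hz
  obtain ⟨L, hL⟩ := exists_log_complex ⟨F, hF⟩ fun z => by
    by_cases hz : z ∈ U
    · simp only [ContinuousMap.coe_mk, F, if_pos hz]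
      exact div_ne_zero (Complex.exp_ne_zero _) (hw0 z (Or.inl hz))
    · simp only [ContinuousMap.coe_mk, F, if_neg hz]
      exact zpow_ne_zero _ (sub_ne_zero.2 fun h => hz (h ▸ hpU))
  obtain ⟨R, hR⟩ := hb.subset_ball p
  have hR0 : 0 < R := Metric.pos_of_mem_ball (hR hpU)
  refine hasLog_sphere (c := p) hR0 ⟨L, L.continuous.continuousOn, fun z hz => ?_⟩
  have hzU : z ∉ U := fun h => (Metric.mem_ball.1 (hR h)).ne (Metric.mem_sphere.1 hz)
  rw [hL]
  simp only [ContinuousMap.coe_mk, F, if_neg hzU]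

lemma isPreconnected_compl_closedBall (R : ℝ) (hR : 0 ≤ R) :
    IsPreconnected (Metric.closedBall (0 : ℂ) R)ᶜ := by
  have : (Metric.closedBall (0 : ℂ) R)ᶜ =
      (fun x : ℝ × ℝ => circleMap 0 x.1 x.2) '' (Set.Ioi R ×ˢ Set.univ) := by
    ext z
    simp only [Set.mem_compl_iff, mem_closedBall_zero_iff, not_le, Set.mem_image, Set.mem_prod,
      Set.mem_Ioi, Set.mem_univ, and_true, Prod.exists]
    constructor
    · intro hz
      exact ⟨‖z‖, z.arg, hz, by simp [circleMap]⟩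
    · rintro ⟨r, t, hr, rfl⟩
      simpa [circleMap, abs_of_pos (hR.trans_lt hr)] using hr
  rw [this]
  refine (isPreconnected_Ioi.prod isPreconnected_univ).image _ ?_
  unfold circleMap
  fun_prop

/-- There is at most one unbounded component. -/
lemma mem_component_of_not_isBounded (hK : IsCompact K)
    (hp : ¬ Bornology.IsBounded (connectedComponentIn Kᶜ p))
    (hq : ¬ Bornology.IsBounded (connectedComponentIn Kᶜ q)) (hqK : q ∉ K) :
    q ∈ connectedComponentIn Kᶜ p := by
  obtain ⟨R, hR⟩ := hK.isBounded.subset_closedBall (0 : ℂ)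
  have hR' : K ⊆ Metric.closedBall 0 |R| :=
    hR.trans (Metric.closedBall_subset_closedBall (le_abs_self R))
  have key : ∀ x, ¬ Bornology.IsBounded (connectedComponentIn Kᶜ x) →
      ∃ y ∈ (Metric.closedBall (0 : ℂ) |R|)ᶜ, y ∈ connectedComponentIn Kᶜ x := by
    intro x hx
    by_contra! h
    exact hx (Metric.isBounded_closedBall.subset fun y hy => by
      by_contra hy'
      exact h y hy' hy)
  obtain ⟨y, hy, hyp⟩ := key p hp
  obtain ⟨y', hy', hyq⟩ := key q hq
  have := (isPreconnected_compl_closedBall |R| (abs_nonneg R)).subset_connectedComponentIn hy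
    (Set.compl_subset_compl.2 hR')
  rw [← connectedComponentIn_eq hyp] at this
  rw [connectedComponentIn_eq (this hy'), ← connectedComponentIn_eq hyq]
  exact mem_connectedComponentIn hqK

lemma notMem_component_union (hq : q ∉ K) (h : q ∉ connectedComponentIn Kᶜ p) :
    q ∉ connectedComponentIn Kᶜ p ∪ K := fun h' => h'.elim h hq

lemma component_symm (hp : p ∉ K) (h : q ∈ connectedComponentIn Kᶜ p) :
    p ∈ connectedComponentIn Kᶜ q :=
  connectedComponentIn_eq h ▸ mem_connectedComponentIn hp

/-- Eilenberg's criterion. -/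
lemma mem_component_of_hasLog (hK : IsCompact K) (hp : p ∉ K) (hq : q ∉ K)
    (h : HasLog K fun z => (z - p) / (z - q)) : q ∈ connectedComponentIn Kᶜ p := by
  by_contra hqp
  -- A bounded component of p without q would give winding number 1 = 0. So if p and q are
  -- separated, both components are unbounded, hence equal.
  have key : ∀ p q, p ∉ K → q ∉ K → q ∉ connectedComponentIn Kᶜ p →
      HasLog K (fun z => (z - p) / (z - q)) →
      ¬ Bornology.IsBounded (connectedComponentIn Kᶜ p) := by
    intro p q hp hq hqp h hb
    have hq' := notMem_component_union hq hqp
    refine one_ne_zero (eq_zero_of_hasLog (m := 1) (w := fun z => (z - q)⁻¹) hK.isClosed hp hb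
      (ContinuousOn.inv₀ (by fun_prop) fun z hz => sub_ne_zero_of_mem hq' hz)
      (fun z hz => inv_ne_zero (sub_ne_zero_of_mem hq' hz)) (h.congr fun z _ => ?_))
    rw [zpow_one, div_eq_mul_inv]
  refine hqp (mem_component_of_not_isBounded hK (key p q hp hq hqp h) ?_ hq)
  exact key q p hq hp (fun h => hqp (component_symm hq h))
    (h.inv.congr fun z _ => inv_div _ _)

end Eilenberg

end PlaneSeparation

namespace PlaneSeparation

/-! ### The two sides of an arc -/

section Sides

variable {K : Set ℂ} {γ : C(I, ℂ)} {p q r : ℂ}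

/-- The integer n is the defect: the jump between the logarithm on K and its continuation along the
arc. It obstructs the extension over the arc. -/
lemma exists_log_defect {u : ℂ → ℂ} (hu : HasLog K u) (h0 : γ 0 ∈ K) (h1 : γ 1 ∈ K)
    (huc : ContinuousOn u (K ∪ Set.range γ)) (hu0 : ∀ z ∈ K ∪ Set.range γ, u z ≠ 0) :
    ∃ (g : ℂ → ℂ) (h : C(I, ℂ)) (n : ℤ), ContinuousOn g K ∧ (∀ z ∈ K, Complex.exp (g z) = u z) ∧
      (∀ t, Complex.exp (h t) = u (γ t)) ∧ h 0 = g (γ 0) ∧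
      h 1 = g (γ 1) + n * (2 * Real.pi * Complex.I) := by
  obtain ⟨g, hg, hgu⟩ := hu
  obtain ⟨h, hh0, hh⟩ := exists_log_path γ Set.subset_union_right huc hu0 (hgu _ h0)
  obtain ⟨n, hn⟩ := Complex.exp_eq_exp_iff_exists_int.1 ((hh 1).trans (hgu _ h1).symm)
  exact ⟨g, h, n, hg, hgu, hh, hh0, hn⟩

/-- A logarithm without defect extends over an arc. -/
lemma HasLog.attach_arc (hK : IsClosed K)
    (hγ : ∀ s t, γ s = γ t → s = t ∨ (s = 0 ∧ t = 1) ∨ (s = 1 ∧ t = 0))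
    (hγK : ∀ t ∈ Set.Ioo (0 : I) 1, γ t ∉ K)
    {u g : ℂ → ℂ} (hg : ContinuousOn g K) (hgu : ∀ z ∈ K, Complex.exp (g z) = u z) {h : C(I, ℂ)}
    (hh : ∀ t, Complex.exp (h t) = u (γ t)) (hh0 : h 0 = g (γ 0)) (hh1 : h 1 = g (γ 1)) :
    HasLog (K ∪ Set.range γ) u := by
  refine HasLog.attach hK hg hgu γ h hh (fun s t hst => ?_) fun t ht => ?_
  · obtain rfl | ⟨rfl, rfl⟩ | ⟨rfl, rfl⟩ := hγ s t hst
    · rfl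
    · rw [hh0, hh1, hst]
    · rw [hh0, hh1, hst]
  · by_cases ht0 : t = 0
    · rw [ht0, hh0]
    · by_cases ht1 : t = 1
      · rw [ht1, hh1]
      · exact (hγK t ⟨unitInterval.pos_iff_ne_zero.2 ht0, unitInterval.lt_one_iff_ne_one.2 ht1⟩
          ht).elim

lemma continuousOn_sub_div_sub {L : Set ℂ} (hr : r ∉ L) :
    ContinuousOn (fun z => (z - p) / (z - r)) L :=
  ContinuousOn.div (by fun_prop) (by fun_prop) fun _ hz => sub_ne_zero_of_mem hr hz

lemma sub_div_sub_ne_zero {L : Set ℂ} (hp : p ∉ L) (hr : r ∉ L) :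
    ∀ z ∈ L, (z - p) / (z - r) ≠ 0 := fun _ hz =>
  div_ne_zero (sub_ne_zero_of_mem hp hz) (sub_ne_zero_of_mem hr hz)

/-- The functions (z - p)/(z - r) and (z - q)/(z - r) have logarithms on K with defects n₁ and n₂.
In the product of their powers with exponents n₂ and -n₁ the defects cancel, so its logarithm
extends over the arc. Winding around the bounded components of p and q forces n₂ = 0 and n₁ = 0.
Then the first logarithm extends by itself, and p and r are not separated. -/
lemma false_of_three_components_of_isBounded (hK : IsCompact K)
    (hγ : ∀ s t, γ s = γ t → s = t ∨ (s = 0 ∧ t = 1) ∨ (s = 1 ∧ t = 0))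
    (hγK : ∀ t ∈ Set.Ioo (0 : I) 1, γ t ∉ K) (h0 : γ 0 ∈ K) (h1 : γ 1 ∈ K)
    (hp : p ∉ K ∪ Set.range γ) (hq : q ∉ K ∪ Set.range γ) (hr : r ∉ K ∪ Set.range γ)
    (hpr' : r ∈ connectedComponentIn Kᶜ p) (hqr' : r ∈ connectedComponentIn Kᶜ q)
    (hpb : Bornology.IsBounded (connectedComponentIn (K ∪ Set.range γ)ᶜ p))
    (hqb : Bornology.IsBounded (connectedComponentIn (K ∪ Set.range γ)ᶜ q))
    (hpq : q ∉ connectedComponentIn (K ∪ Set.range γ)ᶜ p)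
    (hpr : r ∉ connectedComponentIn (K ∪ Set.range γ)ᶜ p)
    (hqr : r ∉ connectedComponentIn (K ∪ Set.range γ)ᶜ q) : False := by
  have hKγ : IsCompact (K ∪ Set.range γ) := hK.union (isCompact_range γ.continuous)
  have hpK : p ∉ K := fun h => hp (Or.inl h)
  have hqK : q ∉ K := fun h => hq (Or.inl h)
  obtain ⟨g₁, k₁, n₁, hg₁, hgu₁, hk₁, hk₁0, hk₁1⟩ := exists_log_defect
    (hasLog_of_mem_component hK.isClosed hpK hpr') h0 h1
    (continuousOn_sub_div_sub hr) (sub_div_sub_ne_zero hp hr)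
  obtain ⟨g₂, k₂, n₂, hg₂, hgu₂, hk₂, hk₂0, hk₂1⟩ := exists_log_defect
    (hasLog_of_mem_component hK.isClosed hqK hqr') h0 h1
    (continuousOn_sub_div_sub hr) (sub_div_sub_ne_zero hq hr)
  have hlog : HasLog (K ∪ Set.range γ)
      fun z => ((z - p) / (z - r)) ^ n₂ * ((z - q) / (z - r)) ^ (-n₁) := by
    refine HasLog.attach_arc hK.isClosed hγ hγK (g := fun z => n₂ * g₁ z + (-n₁ : ℤ) * g₂ z)
      (by fun_prop) (fun z hz => ?_)
      (h := ⟨fun t => n₂ * k₁ t + (-n₁ : ℤ) * k₂ t, by fun_prop⟩) (fun t => ?_) ?_ ?_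
    · rw [Complex.exp_add, Complex.exp_int_mul, Complex.exp_int_mul, hgu₁ z hz, hgu₂ z hz]
    · simp only [ContinuousMap.coe_mk]
      rw [Complex.exp_add, Complex.exp_int_mul, Complex.exp_int_mul, hk₁, hk₂]
    · simp only [ContinuousMap.coe_mk, hk₁0, hk₂0]
    · simp only [ContinuousMap.coe_mk, hk₁1, hk₂1]
      push_cast
      ring
  have hn₂ : n₂ = 0 := by
    have hr' := notMem_component_union hr hpr
    have hq' := notMem_component_union hq hpq
    refine eq_zero_of_hasLog (w := fun z => (z - r) ^ (-n₂) * ((z - q) / (z - r)) ^ (-n₁))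
      hKγ.isClosed hp hpb ?_ ?_ (hlog.congr fun z hz => ?_)
    · refine ContinuousOn.mul (ContinuousOn.zpow₀ (by fun_prop) _ fun z hz =>
        Or.inl (sub_ne_zero_of_mem hr' hz)) (ContinuousOn.zpow₀ (continuousOn_sub_div_sub hr') _
          fun z hz => Or.inl (sub_div_sub_ne_zero hq' hr' z hz))
    · exact fun z hz => mul_ne_zero (zpow_ne_zero _ (sub_ne_zero_of_mem hr' hz))
        (zpow_ne_zero _ (sub_div_sub_ne_zero hq' hr' z hz))
    · rw [div_zpow (z - p), zpow_neg (z - r), div_eq_mul_inv, mul_assoc]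
  have hn₁ : n₁ = 0 := by
    have hr' := notMem_component_union hr hqr
    rw [hn₂] at hlog
    refine neg_eq_zero.1 (eq_zero_of_hasLog (m := -n₁) (w := fun z => (z - r) ^ n₁)
      hKγ.isClosed hq hqb ?_ ?_ (hlog.congr fun z hz => ?_))
    · exact ContinuousOn.zpow₀ (by fun_prop) _ fun z hz =>
        Or.inl (sub_ne_zero_of_mem hr' hz)
    · exact fun z hz => zpow_ne_zero _ (sub_ne_zero_of_mem hr' hz)
    · rw [zpow_zero, one_mul, div_zpow, zpow_neg (z - r), div_inv_eq_mul]
  refine hpr (mem_component_of_hasLog hKγ hp hr (HasLog.attach_arc hK.isClosed hγ hγK hg₁ hgu₁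
    hk₁ hk₁0 ?_))
  rw [hk₁1, hn₁]
  simp

/-- Attaching an arc divides a component of the complement into at most two. -/
lemma false_of_three_components (hK : IsCompact K)
    (hγ : ∀ s t, γ s = γ t → s = t ∨ (s = 0 ∧ t = 1) ∨ (s = 1 ∧ t = 0))
    (hγK : ∀ t ∈ Set.Ioo (0 : I) 1, γ t ∉ K) (h0 : γ 0 ∈ K) (h1 : γ 1 ∈ K)
    (hp : p ∉ K ∪ Set.range γ) (hq : q ∉ K ∪ Set.range γ) (hr : r ∉ K ∪ Set.range γ)
    (hpr' : r ∈ connectedComponentIn Kᶜ p) (hqr' : r ∈ connectedComponentIn Kᶜ q)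
    (hpq : q ∉ connectedComponentIn (K ∪ Set.range γ)ᶜ p)
    (hpr : r ∉ connectedComponentIn (K ∪ Set.range γ)ᶜ p)
    (hqr : r ∉ connectedComponentIn (K ∪ Set.range γ)ᶜ q) : False := by
  have hKγ : IsCompact (K ∪ Set.range γ) := hK.union (isCompact_range γ.continuous)
  have hpK : p ∉ K := fun h => hp (Or.inl h)
  have hqK : q ∉ K := fun h => hq (Or.inl h)
  have hpq' : q ∈ connectedComponentIn Kᶜ p :=
    connectedComponentIn_eq hpr' ▸ component_symm hqK hqr'
  -- At most one of the three components is unbounded; its point takes the role of the reference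
  -- point r.
  by_cases hpb : Bornology.IsBounded (connectedComponentIn (K ∪ Set.range γ)ᶜ p)
  · by_cases hqb : Bornology.IsBounded (connectedComponentIn (K ∪ Set.range γ)ᶜ q)
    · exact false_of_three_components_of_isBounded hK hγ hγK h0 h1 hp hq hr hpr' hqr' hpb hqb
        hpq hpr hqr
    · have hrb : Bornology.IsBounded (connectedComponentIn (K ∪ Set.range γ)ᶜ r) := by
        by_contra hrb
        exact hqr (mem_component_of_not_isBounded hKγ hqb hrb hr)
      exact false_of_three_components_of_isBounded hK hγ hγK h0 h1 hp hr hq hpq'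
        (component_symm hqK hqr') hpb hrb hpr hpq fun h => hqr (component_symm hr h)
  · have hqb : Bornology.IsBounded (connectedComponentIn (K ∪ Set.range γ)ᶜ q) := by
      by_contra hqb
      exact hpq (mem_component_of_not_isBounded hKγ hpb hqb hq)
    have hrb : Bornology.IsBounded (connectedComponentIn (K ∪ Set.range γ)ᶜ r) := by
      by_contra hrb
      exact hpr (mem_component_of_not_isBounded hKγ hpb hrb hr)
    exact false_of_three_components_of_isBounded hK hγ hγK h0 h1 hq hr hp (component_symm hpK hpq')
        (component_symm hpK hpr') hqb hrb hqr (fun h => hpq (component_symm hq h))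
        fun h => hpr (component_symm hr h)

lemma exists_Ioo_subset_of_mem_nhds {t : I} (ht : t ∈ Set.Ioo (0 : I) 1) {s : Set I}
    (hs : s ∈ nhds t) : ∃ a b : I, 0 < a ∧ a < t ∧ t < b ∧ b < 1 ∧ Set.Icc a b ⊆ s := by
  obtain ⟨l, u, ⟨hl, hu⟩, hlu⟩ := (mem_nhds_iff_exists_Ioo_subset' ⟨0, ht.1⟩ ⟨1, ht.2⟩).1 hs
  obtain ⟨a, hla, hat⟩ := exists_between hl
  obtain ⟨b, htb, hbu⟩ := exists_between hu
  exact ⟨a, b, (zero_le : 0 ≤ l).trans_lt hla, hat, htb, hbu.trans_le unitInterval.le_one',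
    fun x hx => hlu ⟨hla.trans_le hx.1, hx.2.trans_lt hbu⟩⟩

/-- If an arc divides a component of the complement, then all its interior points are on the
boundary of both parts. -/
lemma mem_closure_component (hK : IsCompact K)
    (hγ : ∀ s t, γ s = γ t → s = t ∨ (s = 0 ∧ t = 1) ∨ (s = 1 ∧ t = 0))
    (hγK : ∀ t ∈ Set.Ioo (0 : I) 1, γ t ∉ K) (h0 : γ 0 ∈ K) (h1 : γ 1 ∈ K)
    (hp : p ∉ K ∪ Set.range γ) (hq : q ∉ K ∪ Set.range γ)
    (hpq' : q ∈ connectedComponentIn Kᶜ p)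
    (hpq : q ∉ connectedComponentIn (K ∪ Set.range γ)ᶜ p) {t : I} (ht : t ∈ Set.Ioo (0 : I) 1) :
    γ t ∈ closure (connectedComponentIn (K ∪ Set.range γ)ᶜ p) := by
  by_contra hcl
  have hKγ : IsCompact (K ∪ Set.range γ) := hK.union (isCompact_range γ.continuous)
  set F := connectedComponentIn (K ∪ Set.range γ)ᶜ p with hF
  obtain ⟨a, b, ha0, hat, htb, hb1, hab⟩ := exists_Ioo_subset_of_mem_nhds ht
    (γ.continuous.continuousAt.preimage_mem_nhds (isClosed_closure.isOpen_compl.mem_nhds hcl))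
  have hσ0 : 0 < unitInterval.symm b := by
    rw [unitInterval.pos_iff_ne_zero, Ne, unitInterval.symm_eq_zero]
    exact hb1.ne
  -- What remains of the arc after removing the part between a and b, which stays away from the
  -- closure of F. The second piece is traversed backwards, so that both start on K.
  let γ₁ : C(I, ℂ) := ⟨fun τ => γ (τ * a), by fun_prop⟩
  let γ₂ : C(I, ℂ) := ⟨fun τ => γ (unitInterval.symm (τ * unitInterval.symm b)), by fun_prop⟩
  have hle₁ : ∀ τ : I, τ * a ≤ a := fun τ => unitInterval.mul_le_right
  have hle₂ : ∀ τ : I, b ≤ unitInterval.symm (τ * unitInterval.symm b) := fun τ =>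
    unitInterval.le_symm_comm.1 unitInterval.mul_le_right
  have hinj₁ : Function.Injective γ₁ := by
    intro s t hst
    obtain h | ⟨h, h'⟩ | ⟨h, h'⟩ := hγ _ _ hst
    · have := congrArg Subtype.val h
      exact Subtype.ext (mul_right_cancel₀ (fun h => ha0.ne' (Subtype.ext h)) this)
    · exact absurd h' ((hle₁ t).trans_lt (hat.trans ht.2)).ne
    · exact absurd h ((hle₁ s).trans_lt (hat.trans ht.2)).ne
  have hinj₂ : Function.Injective γ₂ := by
    intro s t hst
    obtain h | ⟨h, h'⟩ | ⟨h, h'⟩ := hγ _ _ hst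
    · have := congrArg Subtype.val (unitInterval.symm_inj.1 h)
      exact Subtype.ext (mul_right_cancel₀ (fun h => hσ0.ne' (Subtype.ext h)) this)
    · exact absurd h ((ht.1.trans htb).trans_le (hle₂ s)).ne'
    · exact absurd h' ((ht.1.trans htb).trans_le (hle₂ t)).ne'
  have hsub₁ : Set.range γ₁ ⊆ Set.range γ := by
    rintro _ ⟨τ, rfl⟩
    exact ⟨_, rfl⟩
  have hsub₂ : Set.range γ₂ ⊆ Set.range γ := by
    rintro _ ⟨τ, rfl⟩
    exact ⟨_, rfl⟩
  have hsubK₁ : K ∪ Set.range γ₁ ⊆ K ∪ Set.range γ := Set.union_subset_union_right _ hsub₁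
  have hsubK₂ : K ∪ Set.range γ₁ ∪ Set.range γ₂ ⊆ K ∪ Set.range γ :=
    Set.union_subset hsubK₁ (hsub₂.trans Set.subset_union_right)
  have hK₁ : IsCompact (K ∪ Set.range γ₁) := hK.union (isCompact_range γ₁.continuous)
  have hK₂ : IsCompact (K ∪ Set.range γ₁ ∪ Set.range γ₂) :=
    hK₁.union (isCompact_range γ₂.continuous)
  have hKt : ∀ s : I, γ s ∈ K → s = 0 ∨ s = 1 := by
    intro s hs
    by_contra! h
    exact hγK s ⟨unitInterval.pos_iff_ne_zero.2 h.1, unitInterval.lt_one_iff_ne_one.2 h.2⟩ hs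
  -- Hanging pieces have no defect, so without the middle part p and q are not separated.
  have hlog : HasLog (K ∪ Set.range γ₁ ∪ Set.range γ₂) fun z => (z - p) / (z - q) := by
    refine HasLog.attach_hanging hK₁.isClosed (HasLog.attach_hanging hK.isClosed
      (hasLog_of_mem_component hK.isClosed (fun h => hp (Or.inl h)) hpq') γ₁ hinj₁ ?_ ?_
      ?_ ?_) γ₂ hinj₂ ?_ ?_ ?_ ?_
    · simpa [γ₁] using h0
    · intro τ hτ
      obtain h | h := hKt _ hτ
      · have := congrArg Subtype.val h
        exact Subtype.ext ((mul_eq_zero.1 this).resolve_right fun h => ha0.ne' (Subtype.ext h))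
      · exact absurd h ((hle₁ τ).trans_lt (hat.trans ht.2)).ne
    · exact continuousOn_sub_div_sub fun h => hq (hsubK₁ h)
    · exact sub_div_sub_ne_zero (fun h => hp (hsubK₁ h)) (fun h => hq (hsubK₁ h))
    · left
      simpa [γ₂] using h1
    · have hone : ∀ τ : I, unitInterval.symm (τ * unitInterval.symm b) = 1 → τ = 0 := by
        intro τ h
        have := congrArg Subtype.val (unitInterval.symm_eq_one.1 h)
        exact Subtype.ext ((mul_eq_zero.1 this).resolve_right fun h => hσ0.ne' (Subtype.ext h))
      rintro τ (hτ | ⟨s, hs⟩)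
      · obtain h | h := hKt _ hτ
        · exact absurd h ((ht.1.trans htb).trans_le (hle₂ τ)).ne'
        · exact hone τ h
      · obtain h | ⟨-, h⟩ | ⟨h, -⟩ := hγ _ _ hs
        · exact absurd h ((hle₁ s).trans_lt ((hat.trans htb).trans_le (hle₂ τ))).ne
        · exact hone τ h
        · exact absurd h ((hle₁ s).trans_lt (hat.trans ht.2)).ne
    · exact continuousOn_sub_div_sub fun h => hq (hsubK₂ h)
    · exact sub_div_sub_ne_zero (fun h => hp (hsubK₂ h)) (fun h => hq (hsubK₂ h))
  have hpK₂ : p ∉ K ∪ Set.range γ₁ ∪ Set.range γ₂ := fun h => hp (hsubK₂ h)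
  -- F is relatively closed in this larger component: further limit points would lie on the removed
  -- part of the arc. Hence F contains the component, and with it q.
  refine hpq (isPreconnected_connectedComponentIn.subset_of_closure_inter_subset
    hKγ.isClosed.isOpen_compl.connectedComponentIn
    ⟨p, mem_connectedComponentIn hpK₂, mem_connectedComponentIn hp⟩ ?_
    (mem_component_of_hasLog hK₂ hpK₂ (fun h => hq (hsubK₂ h)) hlog))
  rintro z ⟨hzF, hzU⟩
  have hz₂ : z ∉ K ∪ Set.range γ₁ ∪ Set.range γ₂ := connectedComponentIn_subset _ _ hzU
  obtain h | h | ⟨s, rfl⟩ := closure_component_subset hKγ.isClosed p hzF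
  · exact h
  · exact (hz₂ (Or.inl (Or.inl h))).elim
  · by_cases hsa : s ≤ a
    · refine (hz₂ (Or.inl (Or.inr ⟨⟨s / a, ?_⟩, ?_⟩))).elim
      · exact unitInterval.div_mem s.2.1 a.2.1 hsa
      · simp only [γ₁, ContinuousMap.coe_mk]
        congr 1
        exact Subtype.ext (div_mul_cancel₀ _ fun h => ha0.ne' (Subtype.ext h))
    · by_cases hsb : b ≤ s
      · refine (hz₂ (Or.inr ⟨⟨unitInterval.symm s / unitInterval.symm b, ?_⟩, ?_⟩)).elim
        · exact unitInterval.div_mem (unitInterval.symm s).2.1 (unitInterval.symm b).2.1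
            (unitInterval.symm_le_symm.2 hsb)
        · simp only [γ₂, ContinuousMap.coe_mk]
          congr 1
          rw [← unitInterval.symm_inj, unitInterval.symm_symm]
          exact Subtype.ext (div_mul_cancel₀ _ fun h => hσ0.ne' (Subtype.ext h))
      · exact (hab ⟨(not_le.1 hsa).le, (not_le.1 hsb).le⟩ hzF).elim

lemma isPreconnected_ball_diff_center (c : ℂ) (ε : ℝ) :
    IsPreconnected (Metric.ball c ε \ {c}) := by
  have : Metric.ball c ε \ {c} =
      (fun x : ℝ × ℝ => circleMap c x.1 x.2) '' (Set.Ioo 0 ε ×ˢ Set.univ) := by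
    ext z
    simp only [Set.mem_sdiff, mem_ball_iff_norm, Set.mem_singleton_iff, Set.mem_image, Set.mem_prod,
      Set.mem_Ioo, Set.mem_univ, and_true, Prod.exists]
    constructor
    · rintro ⟨hz, hzc⟩
      exact ⟨‖z - c‖, (z - c).arg, ⟨norm_pos_iff.2 (sub_ne_zero.2 hzc), hz⟩, by simp [circleMap]⟩
    · rintro ⟨r, t, ⟨hr0, hr⟩, rfl⟩
      refine ⟨by simpa [circleMap, abs_of_pos hr0] using hr, ?_⟩
      simp [circleMap, hr0.ne']
  rw [this]
  refine (isPreconnected_Ioo.prod isPreconnected_univ).image _ ?_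
  unfold circleMap
  fun_prop

/-- An arc has no interior points. -/
lemma mem_closure_compl (hK : IsClosed K)
    (hγ : ∀ s t, γ s = γ t → s = t ∨ (s = 0 ∧ t = 1) ∨ (s = 1 ∧ t = 0))
    (hγK : ∀ t ∈ Set.Ioo (0 : I) 1, γ t ∉ K) (h0 : γ 0 ∈ K)
    {t : I} (ht : t ∈ Set.Ioo (0 : I) 1) : γ t ∈ closure (K ∪ Set.range γ)ᶜ := by
  by_contra hcl
  obtain ⟨ε, hε, hball⟩ := Metric.isOpen_iff.1 (isClosed_closure.isOpen_compl.inter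
    hK.isOpen_compl) (γ t) ⟨hcl, hγK t ht⟩
  have hball' : ∀ z ∈ Metric.ball (γ t) ε, z ∉ K ∧ z ∈ Set.range γ := by
    intro z hz
    have hz' := hball hz
    refine ⟨hz'.2, ?_⟩
    by_contra h
    exact hz'.1 (subset_closure fun h' => h'.elim hz'.2 h)
  obtain ⟨a, b, ha0, hat, htb, hb1, hab⟩ := exists_Ioo_subset_of_mem_nhds ht
    (γ.continuous.continuousAt.preimage_mem_nhds (Metric.ball_mem_nhds (γ t) hε))
  have hne : ∀ s : I, s ≠ t → γ s ≠ γ t := by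
    intro s hs h
    obtain h | ⟨-, h⟩ | ⟨-, h⟩ := hγ _ _ h
    exacts [hs h, ht.2.ne h, ht.1.ne' h]
  -- If the arc filled a ball, its two closed halves at t would cover the connected punctured ball
  -- and meet there. But they share only γ t and, for a closed arc, the endpoint, which is in K.
  obtain ⟨z, ⟨hz, hzt⟩, ⟨s, hs, rfl⟩, s', hs', hss'⟩ := isPreconnected_closed_iff.1
    (isPreconnected_ball_diff_center (γ t) ε) (γ '' Set.Icc 0 t) (γ '' Set.Icc t 1)
    (isCompact_Icc.image γ.continuous).isClosed (isCompact_Icc.image γ.continuous).isClosed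
    (by
      rintro z ⟨hz, -⟩
      obtain ⟨s, rfl⟩ := (hball' z hz).2
      obtain h | h := le_total s t
      · exact Or.inl ⟨s, ⟨unitInterval.nonneg', h⟩, rfl⟩
      · exact Or.inr ⟨s, ⟨h, unitInterval.le_one'⟩, rfl⟩)
    ⟨γ a, ⟨hab ⟨le_rfl, (hat.trans htb).le⟩, hne a hat.ne⟩, a, ⟨ha0.le, hat.le⟩, rfl⟩
    ⟨γ b, ⟨hab ⟨(hat.trans htb).le, le_rfl⟩, hne b htb.ne'⟩, b, ⟨htb.le, hb1.le⟩, rfl⟩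
  obtain h | ⟨-, h⟩ | ⟨-, h⟩ := hγ _ _ hss'
  · subst h
    exact hzt (congrArg γ (le_antisymm hs.2 hs'.1))
  · exact absurd h (hs.2.trans_lt ht.2).ne
  · subst h
    exact (hball' _ hz).1 h0

end Sides

/-! ### Two paths with common endpoints separate the plane -/

section Jordan

variable {a b : ℂ}

/-- Moving the point γ s from a to b deforms the constant 1 into (z - b)/(z - a) without zeros off
the path. -/
lemma hasLog_compl_range (γ : C(I, ℂ)) (h0 : γ 0 = a) (h1 : γ 1 = b) :
    HasLog (Set.range γ)ᶜ fun z => (z - b) / (z - a) := by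
  classical
  have hne : ∀ (z : ((Set.range γ)ᶜ : Set ℂ)) (t : I), (z : ℂ) - γ t ≠ 0 := fun z t =>
    sub_ne_zero.2 fun h => z.2 ⟨t, h.symm⟩
  have hne0 : ∀ z : ((Set.range γ)ᶜ : Set ℂ), (z : ℂ) - a ≠ 0 := fun z => h0 ▸ hne z 0
  obtain ⟨g, hg⟩ := exists_log_of_homotopy (X := ((Set.range γ)ᶜ : Set ℂ))
    ⟨fun p => ((p.2 : ℂ) - γ p.1) / ((p.2 : ℂ) - a),
      by fun_prop (disch := exact fun p => hne0 p.2)⟩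
    (fun p => div_ne_zero (hne p.2 p.1) (hne0 p.2))
    (fun z => by simp only [ContinuousMap.coe_mk, h0, div_self (hne0 z)])
  refine ⟨fun z => if hz : z ∈ (Set.range γ)ᶜ then g ⟨z, hz⟩ else 0, ?_, fun z hz => ?_⟩
  · rw [continuousOn_iff_continuous_domRestrict]
    convert g.continuous using 1
    ext z
    exact dif_pos z.2
  · simp only [dif_pos hz]
    rw [hg]
    simp [h1]

/-- A circle about a of half the distance to b separates the two points, so Eilenberg's criterion
rules out a logarithm even there. -/
lemma not_hasLog_compl_pair (hab : a ≠ b) :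
    ¬ HasLog ({a, b}ᶜ : Set ℂ) fun z => (z - b) / (z - a) := by
  intro h
  have hd : 0 < dist b a / 2 := half_pos (dist_pos.2 hab.symm)
  set ρ := dist b a / 2 with hρ
  have haS : a ∉ Metric.sphere a ρ := fun h => by
    rw [Metric.mem_sphere, dist_self] at h
    exact hd.ne h
  have hbS : b ∉ Metric.sphere a ρ := fun h => by
    rw [Metric.mem_sphere] at h
    linarith
  have hsub : Metric.sphere a ρ ⊆ {a, b}ᶜ := by
    rintro z hz (rfl | rfl)
    exacts [haS hz, hbS hz]
  have hmem := mem_component_of_hasLog (isCompact_sphere a ρ) hbS haS (h.mono hsub)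
  obtain ⟨z, hz, hzd⟩ := isPreconnected_connectedComponentIn.intermediate_value hmem
    (mem_connectedComponentIn hbS) (f := fun z => dist z a) (by fun_prop)
    (show ρ ∈ Set.Icc (dist a a) (dist b a) by rw [dist_self]; constructor <;> linarith)
  exact connectedComponentIn_subset _ _ hz (Metric.mem_sphere.2 hzd)

/-- Two paths with the same distinct endpoints and no other points in common separate the plane,
even together with any closed set that contains one of them and does not meet the interior of the
other. -/
lemma not_isPreconnected_compl (hab : a ≠ b) (γ₁ γ₂ : C(I, ℂ)) (h₁0 : γ₁ 0 = a) (h₁1 : γ₁ 1 = b)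
    (h₂0 : γ₂ 0 = a) (h₂1 : γ₂ 1 = b) {R : Set ℂ} (hR : IsClosed R) (h₂R : Set.range γ₂ ⊆ R)
    (h₁R : ∀ t, γ₁ t ∈ R → γ₁ t = a ∨ γ₁ t = b) : ¬ IsPreconnected (R ∪ Set.range γ₁)ᶜ := by
  classical
  intro hpre
  obtain ⟨g₁, hg₁, hgu₁⟩ := hasLog_compl_range γ₁ h₁0 h₁1
  obtain ⟨g₂, hg₂, hgu₂⟩ :=
    (hasLog_compl_range γ₂ h₂0 h₂1).mono (Set.compl_subset_compl.2 h₂R)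
  have hs1 : (R ∪ Set.range γ₁)ᶜ ⊆ (Set.range γ₁)ᶜ :=
    Set.compl_subset_compl.2 Set.subset_union_right
  have hs2 : (R ∪ Set.range γ₁)ᶜ ⊆ Rᶜ := Set.compl_subset_compl.2 Set.subset_union_left
  have hexp : ∀ z ∈ (R ∪ Set.range γ₁)ᶜ, Complex.exp (g₁ z - g₂ z) = 1 := by
    intro z hz
    rw [Complex.exp_sub, hgu₁ z (hs1 hz), ← hgu₂ z (hs2 hz), div_self (Complex.exp_ne_zero _)]
  -- On a connected overlap the two logarithms differ by a constant period. Shifting one of them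
  -- glues them to a logarithm off `Set.range γ₁ ∩ R`, a subset of {a, b}.
  obtain ⟨c, hc1, hc⟩ : ∃ c : ℂ, Complex.exp c = 1 ∧
      ∀ z ∈ (R ∪ Set.range γ₁)ᶜ, g₁ z = g₂ z + c := by
    by_cases hne : ((R ∪ Set.range γ₁)ᶜ).Nonempty
    · obtain ⟨w, hw⟩ := hne
      refine ⟨g₁ w - g₂ w, hexp w hw, fun z hz => ?_⟩
      have := eq_of_exp_eq_const (k := fun z => g₁ z - g₂ z) hpre
        ((hg₁.mono hs1).sub (hg₂.mono hs2)) hexp hz hw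
      linear_combination this
    · exact ⟨0, Complex.exp_zero, fun z hz => (hne ⟨z, hz⟩).elim⟩
  have hγ₁cl : IsClosed (Set.range γ₁) := (isCompact_range γ₁.continuous).isClosed
  refine not_hasLog_compl_pair hab (HasLog.mono (K := (Set.range γ₁)ᶜ ∪ Rᶜ)
    ⟨fun z => if z ∈ Set.range γ₁ then g₂ z + c else g₁ z, ?_, ?_⟩ ?_)
  · refine ContinuousOn.union_of_isOpen ?_ ?_ hγ₁cl.isOpen_compl hR.isOpen_compl
    · exact hg₁.congr fun z hz => if_neg hz
    · refine (hg₂.add (continuousOn_const (c := c))).congr fun z hz => ?_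
      by_cases hz1 : z ∈ Set.range γ₁
      · exact if_pos hz1
      · simp only [if_neg hz1]
        exact hc z fun h => h.elim hz hz1
  · intro z hz
    by_cases hz1 : z ∈ Set.range γ₁
    · have hzR : z ∈ Rᶜ := hz.resolve_left fun h => h hz1
      simp only [if_pos hz1]
      rw [Complex.exp_add, hc1, mul_one, hgu₂ z hzR]
    · simp only [if_neg hz1]
      exact hgu₁ z hz1
  · intro z hz
    by_contra h
    rw [Set.mem_union, not_or, Set.notMem_compl_iff, Set.notMem_compl_iff] at h
    obtain ⟨⟨t, rfl⟩, hzR⟩ := h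
    exact hz (h₁R t hzR)

end Jordan

end PlaneSeparation

/-! ### From plane topology to duality of plane graphs. -/

namespace Graph

namespace PlaneEmbedding

open PlaneSeparation

variable {α β : Type*} {G : Graph α β} {D : G.PlaneEmbedding}

/-! ### Partial drawings -/

/-- The drawing of a set of vertices and a set of edges. -/
def drawing (D : G.PlaneEmbedding) (X : Set α) (S : Set β) : Set ℂ :=
  D.pos '' X ∪ ⋃ f ∈ S, Set.range (D.arc f)

section Drawing

variable {X X' : Set α} {S S' : Set β} {f g : β} {x y : α} {z : ℂ}

lemma support_eq_drawing (D : G.PlaneEmbedding) : D.support = D.drawing V(G) E(G) := rfl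

lemma drawing_insert (D : G.PlaneEmbedding) (X : Set α) (f : β) (S : Set β) :
    D.drawing X (insert f S) = D.drawing X S ∪ Set.range (D.arc f) := by
  rw [drawing, drawing, Set.biUnion_insert, Set.union_comm (Set.range _), Set.union_assoc]

lemma drawing_mono (D : G.PlaneEmbedding) (hX : X ⊆ X') (hS : S ⊆ S') :
    D.drawing X S ⊆ D.drawing X' S' :=
  Set.union_subset_union (Set.image_mono hX) (Set.biUnion_subset_biUnion_left hS)

lemma isCompact_drawing (D : G.PlaneEmbedding) (hX : X.Finite) (hS : S.Finite) :
    IsCompact (D.drawing X S) :=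
  (hX.image _).isCompact.union
    (hS.isCompact_biUnion fun f _ => isCompact_range (D.arc f).continuous)

lemma pos_mem_drawing (D : G.PlaneEmbedding) (S : Set β) (hx : x ∈ X) : D.pos x ∈ D.drawing X S :=
  Or.inl ⟨x, hx, rfl⟩

lemma range_arc_subset_drawing (D : G.PlaneEmbedding) (X : Set α) (hf : f ∈ S) :
    Set.range (D.arc f) ⊆ D.drawing X S :=
  (Set.subset_biUnion_of_mem (u := fun f => Set.range (D.arc f)) hf).trans
    Set.subset_union_right

lemma exists_end_of_notMem_Ioo (D : G.PlaneEmbedding) (hl : G.IsLink f x y) {t : I}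
    (ht : t ∉ Set.Ioo (0 : I) 1) : D.arc f t = D.pos x ∨ D.arc f t = D.pos y := by
  have ht' : t = 0 ∨ t = 1 := by
    by_contra! h
    exact ht ⟨unitInterval.pos_iff_ne_zero.2 h.1, unitInterval.lt_one_iff_ne_one.2 h.2⟩
  obtain ⟨h0, h1⟩ | ⟨h0, h1⟩ := D.arc_ends f x y hl <;> obtain rfl | rfl := ht' <;> tauto

lemma mem_drawing_cases (hS : ∀ f ∈ S, f ∈ E(G) ∧ ∀ x y, G.IsLink f x y → x ∈ X)
    (hz : z ∈ D.drawing X S) :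
    (∃ v ∈ X, D.pos v = z) ∨ ∃ f ∈ S, ∃ t ∈ Set.Ioo (0 : I) 1, D.arc f t = z := by
  obtain hz | hz := hz
  · exact Or.inl hz
  · simp only [Set.mem_iUnion] at hz
    obtain ⟨f, hf, t, rfl⟩ := hz
    by_cases ht : t ∈ Set.Ioo (0 : I) 1
    · exact Or.inr ⟨f, hf, t, ht, rfl⟩
    · obtain ⟨hfE, hfX⟩ := hS f hf
      obtain ⟨x, y, hl⟩ := G.exists_isLink_of_mem_edgeSet hfE
      obtain h | h := D.exists_end_of_notMem_Ioo hl ht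
      · exact Or.inl ⟨x, hfX x y hl, h.symm⟩
      · exact Or.inl ⟨y, hfX y x hl.symm, h.symm⟩

lemma mem_drawing_vertexSet_cases (hS : S ⊆ E(G)) (hz : z ∈ D.drawing V(G) S) :
    (∃ v ∈ V(G), D.pos v = z) ∨ ∃ f ∈ S, ∃ t ∈ Set.Ioo (0 : I) 1, D.arc f t = z :=
  mem_drawing_cases (fun _ hf => ⟨hS hf, fun _ _ hl => hl.left_mem⟩) hz

lemma disjoint_drawing (hX : X ⊆ V(G)) (hX' : X' ⊆ V(G)) (hXX' : Disjoint X X')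
    (hSS' : Disjoint S S') (hS : ∀ f ∈ S, f ∈ E(G) ∧ ∀ x y, G.IsLink f x y → x ∈ X)
    (hS' : ∀ f ∈ S', f ∈ E(G) ∧ ∀ x y, G.IsLink f x y → x ∈ X') :
    Disjoint (D.drawing X S) (D.drawing X' S') := by
  refine Set.disjoint_left.2 fun z hz hz' => ?_
  obtain ⟨v, hv, hvz⟩ | ⟨f, hf, t, ht, hfz⟩ := mem_drawing_cases hS hz <;>
    obtain ⟨w, hw, hwz⟩ | ⟨g, hg, s, hs, hgz⟩ := mem_drawing_cases hS' hz'
  · have := D.pos_injOn (hX hv) (hX' hw) (hvz.trans hwz.symm)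
    exact Set.disjoint_left.1 hXX' hv (this ▸ hw)
  · exact D.arc_ne_pos g (hS' g hg).1 s hs v (hX hv) (hgz.trans hvz.symm)
  · exact D.arc_ne_pos f (hS f hf).1 t ht w (hX' hw) (hfz.trans hwz.symm)
  · refine D.arc_disjoint f (hS f hf).1 g (hS' g hg).1 ?_ t ht s hs (hfz.trans hgz.symm)
    rintro rfl
    exact Set.disjoint_left.1 hSS' hf hg

lemma arc_notMem_drawing (hS : S ⊆ E(G)) (hf : f ∈ E(G)) (hfS : f ∉ S) {t : I}
    (ht : t ∈ Set.Ioo (0 : I) 1) : D.arc f t ∉ D.drawing V(G) S := by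
  intro h
  obtain ⟨v, hv, hvz⟩ | ⟨g, hg, s, hs, hgz⟩ := mem_drawing_vertexSet_cases hS h
  · exact D.arc_ne_pos f hf t ht v hv hvz.symm
  · exact D.arc_disjoint g (hS hg) f hf (fun h => hfS (h ▸ hg)) s hs t ht hgz

lemma arc_end_mem_drawing (D : G.PlaneEmbedding) (S : Set β) (hf : f ∈ E(G)) {t : I}
    (ht : t ∉ Set.Ioo (0 : I) 1) : D.arc f t ∈ D.drawing V(G) S := by
  obtain ⟨x, y, hl⟩ := G.exists_isLink_of_mem_edgeSet hf
  obtain h | h := D.exists_end_of_notMem_Ioo hl ht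
  · exact h ▸ D.pos_mem_drawing S hl.left_mem
  · exact h ▸ D.pos_mem_drawing S hl.right_mem

lemma arc_zero_mem_drawing (D : G.PlaneEmbedding) (S : Set β) (hf : f ∈ E(G)) :
    D.arc f 0 ∈ D.drawing V(G) S := D.arc_end_mem_drawing S hf fun h => h.1.ne rfl

lemma arc_one_mem_drawing (D : G.PlaneEmbedding) (S : Set β) (hf : f ∈ E(G)) :
    D.arc f 1 ∈ D.drawing V(G) S := D.arc_end_mem_drawing S hf fun h => h.2.ne rfl

end Drawing

/-! ### Drawings of forests do not separate the plane -/

section Forest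

variable {S : Set β} {f : β} {x y : α}

/-- The ends of f lie in disjoint compact parts of the drawing. Adding a multiple of 2πi on the part
away from `a` removes the defect, so the logarithm extends over f. -/
lemma hasLog_drawing_insert (hV : V(G).Finite) (hS : S.Finite) (hSE : S ⊆ E(G)) {u : ℂ → ℂ}
    (huc : ContinuousOn u (D.drawing V(G) (insert f S)))
    (hu0 : ∀ z ∈ D.drawing V(G) (insert f S), u z ≠ 0)
    (h : HasLog (D.drawing V(G) S) u) (hf : f ∈ E(G)) (hfS : f ∉ S)
    {a b : α} (ha : a ∈ V(G)) (hb : b ∈ V(G)) (h0 : D.arc f 0 = D.pos a) (h1 : D.arc f 1 = D.pos b)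
    (hr : ¬ G.Reach S a b) : HasLog (D.drawing V(G) (insert f S)) u := by
  classical
  rw [drawing_insert] at huc hu0 ⊢
  set X := {v | v ∈ V(G) ∧ G.Reach S a v} with hX
  set A := {g | g ∈ S ∧ ∀ x y, G.IsLink g x y → x ∈ X} with hA
  have hcpt := D.isCompact_drawing (X := X) (S := A) (hV.subset fun _ h => h.1)
    (hS.subset fun _ h => h.1)
  have hcpt' := D.isCompact_drawing (X := V(G) \ X) (S := S \ A) (hV.subset Set.sdiff_subset)
    (hS.subset Set.sdiff_subset)
  have hdisj : Disjoint (D.drawing X A) (D.drawing (V(G) \ X) (S \ A)) := by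
    refine disjoint_drawing (fun _ h => h.1) Set.sdiff_subset disjoint_sdiff_self_right
      disjoint_sdiff_self_right (fun g hg => ⟨hSE hg.1, hg.2⟩) fun g hg => ⟨hSE hg.1, ?_⟩
    intro x y hl
    refine ⟨hl.left_mem, fun hx => hg.2 ⟨hg.1, fun x' y' hl' => ?_⟩⟩
    obtain rfl | rfl := hl'.left_eq_or_eq hl
    · exact hx
    · exact ⟨hl.right_mem, hx.2.trans (hl.reach hg.1)⟩
  have hun : D.drawing V(G) S = D.drawing X A ∪ D.drawing (V(G) \ X) (S \ A) := by
    refine Set.Subset.antisymm ?_ (Set.union_subset (D.drawing_mono (fun _ h => h.1) fun _ h => h.1)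
      (D.drawing_mono Set.sdiff_subset Set.sdiff_subset))
    rintro z (⟨v, hv, rfl⟩ | hz)
    · by_cases hvX : v ∈ X
      · exact Or.inl (D.pos_mem_drawing _ hvX)
      · exact Or.inr (D.pos_mem_drawing _ ⟨hv, hvX⟩)
    · simp only [Set.mem_iUnion] at hz
      obtain ⟨g, hg, hz⟩ := hz
      by_cases hgA : g ∈ A
      · exact Or.inl (D.range_arc_subset_drawing _ hgA hz)
      · exact Or.inr (D.range_arc_subset_drawing _ (show g ∈ S \ A from ⟨hg, hgA⟩) hz)
  have hcl := (D.isCompact_drawing hV hS).isClosed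
  obtain ⟨g, h, n, hg, hgu, hh, hh0, hh1⟩ := exists_log_defect h (D.arc_zero_mem_drawing S hf)
    (D.arc_one_mem_drawing S hf) huc hu0
  have haX : D.arc f 0 ∈ D.drawing X A :=
    h0 ▸ D.pos_mem_drawing A (show a ∈ X from ⟨ha, .refl _ _ _⟩)
  have hbX : D.arc f 1 ∉ D.drawing X A :=
    h1 ▸ Set.disjoint_right.1 hdisj
      (D.pos_mem_drawing _ (show b ∈ V(G) \ X from ⟨hb, fun h => hr h.2⟩))
  refine HasLog.attach_arc hcl (D.arc_simple f hf) (fun t ht => arc_notMem_drawing hSE hf hfS ht)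
    (g := fun z => if z ∈ D.drawing X A then g z else g z + n * (2 * Real.pi * Complex.I))
    ?_ (fun z hz => ?_) hh ?_ ?_
  · rw [hun] at hg ⊢
    refine ContinuousOn.union_of_isClosed ?_ ?_ hcpt.isClosed hcpt'.isClosed
    · exact (hg.mono Set.subset_union_left).congr fun z hz => if_pos hz
    · exact ((hg.mono Set.subset_union_right).add
        (continuousOn_const (c := n * (2 * Real.pi * Complex.I)))).congr
          fun z hz => if_neg (Set.disjoint_right.1 hdisj hz)
  · split_ifs
    · exact hgu z hz
    · rw [Complex.exp_add, Complex.exp_int_mul_two_pi_mul_I, mul_one, hgu z hz]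
  · rw [if_pos haX, hh0]
  · rw [if_neg hbX, hh1]

lemma hasLog_drawing_of_acyclicOn (hV : V(G).Finite) (hE : E(G).Finite) (hS : S ⊆ E(G))
    (hac : G.AcyclicOn S) {u : ℂ → ℂ} (huc : ContinuousOn u (D.drawing V(G) S))
    (hu0 : ∀ z ∈ D.drawing V(G) S, u z ≠ 0) : HasLog (D.drawing V(G) S) u := by
  have hfin := hE.subset hS
  induction S, hfin using Set.Finite.induction_on with
  | empty =>
    refine ⟨fun z => Complex.log (u z), ?_, fun z hz => Complex.exp_log (hu0 z hz)⟩
    have : D.drawing V(G) ∅ = D.pos '' V(G) := by simp [drawing]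
    rw [this]
    exact (hV.image _).continuousOn _
  | @insert f S hfS hfin ih =>
    rw [Set.insert_subset_iff] at hS
    have hsub := D.drawing_mono (subset_refl V(G)) (Set.subset_insert f S)
    have hlog := ih hS.2 (hac.mono (Set.subset_insert f S)) (huc.mono hsub)
      fun z hz => hu0 z (hsub hz)
    obtain ⟨x, y, hl⟩ := G.exists_isLink_of_mem_edgeSet hS.1
    have hr := hac.not_reach hE hl hfS
    obtain ⟨h0, h1⟩ | ⟨h0, h1⟩ := D.arc_ends f x y hl
    · exact hasLog_drawing_insert hV hfin hS.2 huc hu0 hlog hS.1 hfS hl.left_mem hl.right_mem h0 h1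
        hr
    · exact hasLog_drawing_insert hV hfin hS.2 huc hu0 hlog hS.1 hfS hl.right_mem hl.left_mem h0 h1
        fun h => hr h.symm

lemma isPreconnected_compl_drawing (hV : V(G).Finite) (hE : E(G).Finite) (hS : S ⊆ E(G))
    (hac : G.AcyclicOn S) : IsPreconnected (D.drawing V(G) S)ᶜ := by
  refine isPreconnected_of_forall_pair fun p hp q hq => ?_
  refine ⟨_, connectedComponentIn_subset _ _, mem_connectedComponentIn hp, ?_,
    isPreconnected_connectedComponentIn⟩
  exact mem_component_of_hasLog (D.isCompact_drawing hV (hE.subset hS)) hp hq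
    (hasLog_drawing_of_acyclicOn hV hE hS hac (continuousOn_sub_div_sub hq)
      (sub_div_sub_ne_zero hp hq))

end Forest

/-! ### Drawings of cycles separate the plane -/

section Cycle

variable {S : Set β} {f : β} {x y : α} {C : Graph α β}

lemma joinedIn_arc_ends (D : G.PlaneEmbedding) (X : Set α) (hf : f ∈ S) :
    JoinedIn (D.drawing X S) (D.arc f 0) (D.arc f 1) :=
  ⟨⟨D.arc f, rfl, rfl⟩, fun t => D.range_arc_subset_drawing X hf ⟨t, rfl⟩⟩

lemma joinedIn_of_reach (hx : x ∈ V(G)) (h : G.Reach S x y) :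
    JoinedIn (D.drawing V(G) S) (D.pos x) (D.pos y) := by
  refine h.closed (X := {y | JoinedIn (D.drawing V(G) S) (D.pos x) (D.pos y)})
    (JoinedIn.refl (D.pos_mem_drawing S hx)) fun f hf a b hl ha => JoinedIn.trans ha ?_
  have := D.joinedIn_arc_ends V(G) hf
  obtain ⟨h0, h1⟩ | ⟨h0, h1⟩ := D.arc_ends f a b hl
  · rwa [h0, h1] at this
  · rw [h0, h1] at this
    exact this.symm

/-- Any path through the rest of the drawing can serve as the second path, since
`not_isPreconnected_compl` does not ask for injectivity; R is the whole drawing of S. -/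
lemma not_isPreconnected_compl_drawing_of_ne (hV : V(G).Finite) (hE : E(G).Finite) (hS : S ⊆ E(G))
    (hl : G.IsLink f x y) (hfS : f ∉ S) (hxy : x ≠ y) (hr : G.Reach S x y) :
    ¬ IsPreconnected (D.drawing V(G) (insert f S))ᶜ := by
  have hJ : JoinedIn (D.drawing V(G) S) (D.arc f 0) (D.arc f 1) := by
    have := joinedIn_of_reach (D := D) hl.left_mem hr
    obtain ⟨h0, h1⟩ | ⟨h0, h1⟩ := D.arc_ends f x y hl
    · rwa [h0, h1]
    · rw [h0, h1]
      exact this.symm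
  have hne : D.arc f 0 ≠ D.arc f 1 := by
    have : D.pos x ≠ D.pos y := fun h => hxy (D.pos_injOn hl.left_mem hl.right_mem h)
    obtain ⟨h0, h1⟩ | ⟨h0, h1⟩ := D.arc_ends f x y hl
    · rwa [h0, h1]
    · rw [h0, h1]
      exact this.symm
  rw [drawing_insert]
  refine not_isPreconnected_compl hne (D.arc f) hJ.somePath.toContinuousMap rfl rfl
    hJ.somePath.source hJ.somePath.target (D.isCompact_drawing hV (hE.subset hS)).isClosed ?_ ?_
  · rintro _ ⟨t, rfl⟩
    exact hJ.somePath_mem t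
  · intro t ht
    by_contra! h
    refine arc_notMem_drawing hS hl.edge_mem hfS ⟨unitInterval.pos_iff_ne_zero.2 ?_,
      unitInterval.lt_one_iff_ne_one.2 ?_⟩ ht
    · exact fun h' => h.1 (h' ▸ rfl)
    · exact fun h' => h.2 (h' ▸ rfl)

lemma not_isPreconnected_compl_drawing_of_isLoopAt (hV : V(G).Finite) (hE : E(G).Finite)
    (hS : S ⊆ E(G)) (hl : G.IsLoopAt f x) (hfS : f ∉ S) :
    ¬ IsPreconnected (D.drawing V(G) (insert f S))ᶜ := by
  have hf := hl.edge_mem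
  -- The loop is cut at its midpoint into two paths from its vertex; the second half joins the rest
  -- of the drawing as R.
  let m : I := ⟨1 / 2, by norm_num, by norm_num⟩
  have hm0 : (0 : I) < m := Subtype.mk_lt_mk.2 (by norm_num)
  have hm1 : m < 1 := Subtype.mk_lt_mk.2 (by norm_num)
  let γ₁ : C(I, ℂ) := ⟨fun τ => D.arc f (τ * m), by fun_prop⟩
  let γ₂ : C(I, ℂ) := ⟨fun τ => D.arc f (unitInterval.symm (τ * m)), by fun_prop⟩
  have hle : ∀ τ : I, τ * m ≤ m := fun τ => unitInterval.mul_le_right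
  have hsm : unitInterval.symm m = m := Subtype.ext (by simp [m]; norm_num)
  have hge : ∀ τ : I, m ≤ unitInterval.symm (τ * m) := fun τ =>
    unitInterval.le_symm_comm.1 (hsm.symm ▸ hle τ)
  have h01 : D.arc f 0 = D.arc f 1 := by
    obtain ⟨h0, h1⟩ | ⟨h0, h1⟩ := D.arc_ends f x x hl <;> rw [h0, h1]
  have hne : D.arc f 0 ≠ D.arc f m := by
    intro h
    obtain h | ⟨-, h⟩ | ⟨h, -⟩ := D.arc_simple f hf _ _ h
    exacts [hm0.ne h, hm1.ne h, zero_ne_one h]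
  have hR : IsClosed (D.drawing V(G) S ∪ Set.range γ₂) :=
    ((D.isCompact_drawing hV (hE.subset hS)).union (isCompact_range γ₂.continuous)).isClosed
  have hun : Set.range (D.arc f) = Set.range γ₂ ∪ Set.range γ₁ := by
    refine Set.Subset.antisymm ?_ (Set.union_subset ?_ ?_)
    · rintro _ ⟨s, rfl⟩
      obtain h | h := le_total s m
      · refine Or.inr ⟨⟨s / m, unitInterval.div_mem s.2.1 m.2.1 h⟩, congrArg (D.arc f) ?_⟩
        exact Subtype.ext (div_mul_cancel₀ _ fun h => hm0.ne' (Subtype.ext h))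
      · refine Or.inl ⟨⟨unitInterval.symm s / m, unitInterval.div_mem (unitInterval.symm s).2.1 m.2.1
          (unitInterval.symm_le_comm.1 (hsm.symm ▸ h))⟩, congrArg (D.arc f) ?_⟩
        rw [← unitInterval.symm_inj, unitInterval.symm_symm]
        exact Subtype.ext (div_mul_cancel₀ _ fun h => hm0.ne' (Subtype.ext h))
    · rintro _ ⟨τ, rfl⟩
      exact ⟨_, rfl⟩
    · rintro _ ⟨τ, rfl⟩
      exact ⟨_, rfl⟩
  rw [drawing_insert, hun, ← Set.union_assoc]
  refine not_isPreconnected_compl hne γ₁ γ₂ (by simp [γ₁]) (by simp [γ₁])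
    (by simp [γ₂, h01]) (by simp [γ₂, hsm]) hR Set.subset_union_right ?_
  rintro τ (hτ | ⟨s, hs⟩)
  · by_cases h0 : τ * m = 0
    · exact Or.inl (congrArg (D.arc f) h0)
    · exact (arc_notMem_drawing hS hf hfS ⟨unitInterval.pos_iff_ne_zero.2 h0,
        (hle τ).trans_lt hm1⟩ hτ).elim
  · obtain h | ⟨h, -⟩ | ⟨-, h⟩ := D.arc_simple f hf _ _ hs
    · exact Or.inr (congrArg (D.arc f) (le_antisymm (hle τ) (h ▸ hge s)))
    · exact absurd h (hm0.trans_le (hge s)).ne'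
    · exact Or.inl (congrArg (D.arc f) h)

lemma not_isPreconnected_compl_drawing (hV : V(G).Finite) (hE : E(G).Finite) (hS : S ⊆ E(G))
    (hac : ¬ G.AcyclicOn S) : ¬ IsPreconnected (D.drawing V(G) S)ᶜ := by
  unfold AcyclicOn at hac
  push Not at hac
  obtain ⟨C, hCG, hC, hCS⟩ := hac
  obtain ⟨f, hf⟩ := hC.edgeSet_nonempty
  obtain ⟨x, y, hl⟩ := C.exists_isLink_of_mem_edgeSet hf
  have hr : G.Reach (S \ {f}) x y :=
    ((hC.reach_diff (hE.subset hCG.edgeSet_mono) hl).of_le hCG).mono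
      (Set.sdiff_subset_sdiff_left hCS)
  have hins : S = insert f (S \ {f}) := by
    rw [Set.insert_sdiff_singleton, Set.insert_eq_of_mem (hCS hf)]
  have hS' : S \ {f} ⊆ E(G) := Set.sdiff_subset.trans hS
  rw [hins]
  by_cases hxy : x = y
  · subst hxy
    exact not_isPreconnected_compl_drawing_of_isLoopAt hV hE hS' (hl.mono hCG) fun h => h.2 rfl
  · exact not_isPreconnected_compl_drawing_of_ne hV hE hS' (hl.mono hCG) (fun h => h.2 rfl) hxy hr

end Cycle

/-! ### The dual graph -/

section Dual

variable {S : Set β} {f g : β} {F F' : Set ℂ} {p z : ℂ}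

lemma isClosed_support (hV : V(G).Finite) (hE : E(G).Finite) : IsClosed D.support :=
  (D.isCompact_drawing hV hE).isClosed

lemma eq_component_of_mem (hF : F ∈ D.faces) (hp : p ∈ F) :
    F = connectedComponentIn D.supportᶜ p := by
  obtain ⟨q, -, rfl⟩ := hF
  exact connectedComponentIn_eq hp

lemma subset_compl_support (hF : F ∈ D.faces) : F ⊆ D.supportᶜ := by
  obtain ⟨q, -, rfl⟩ := hF
  exact connectedComponentIn_subset _ _

lemma nonempty_of_mem_faces (hF : F ∈ D.faces) : F.Nonempty := by
  obtain ⟨q, hq, rfl⟩ := hF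
  exact ⟨q, mem_connectedComponentIn hq⟩

lemma isPreconnected_of_mem_faces (hF : F ∈ D.faces) : IsPreconnected F := by
  obtain ⟨q, hq, rfl⟩ := hF
  exact isPreconnected_connectedComponentIn

lemma isOpen_of_mem_faces (hV : V(G).Finite) (hE : E(G).Finite) (hF : F ∈ D.faces) : IsOpen F := by
  obtain ⟨q, hq, rfl⟩ := hF
  exact (isClosed_support hV hE).isOpen_compl.connectedComponentIn

lemma component_mem_faces (hp : p ∉ D.support) : connectedComponentIn D.supportᶜ p ∈ D.faces :=
  ⟨p, hp, rfl⟩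

lemma isPreconnected_openArc (D : G.PlaneEmbedding) (f : β) : IsPreconnected (D.openArc f) :=
  isPreconnected_Ioo.image _ (D.arc f).continuous.continuousOn

lemma openArc_nonempty (D : G.PlaneEmbedding) (f : β) : (D.openArc f).Nonempty :=
  (Set.nonempty_Ioo.2 zero_lt_one).image _

lemma openArc_subset_support (hf : f ∈ E(G)) : D.openArc f ⊆ D.support := by
  rintro _ ⟨t, -, rfl⟩
  exact D.range_arc_subset_drawing V(G) hf ⟨t, rfl⟩

/-- An edge has one or two sides, and a neighbourhood that meets no other parts of the drawing and
no other faces. -/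
lemma exists_sides (hV : V(G).Finite) (hE : E(G).Finite) (hf : f ∈ E(G)) :
    ∃ Ω : Set ℂ, IsOpen Ω ∧ D.openArc f ⊆ Ω ∧ Ω ∩ D.support ⊆ D.openArc f ∧
      (∀ p ∈ Ω, p ∉ D.support → connectedComponentIn D.supportᶜ p ∈ D.sides f) ∧
      ∃ F F', D.sides f = {F, F'} := by
  classical
  set K := D.drawing V(G) (E(G) \ {f}) with hKdef
  have hSE : E(G) \ {f} ⊆ E(G) := Set.sdiff_subset
  have hfS : f ∉ E(G) \ {f} := fun h => h.2 rfl
  have hK : IsCompact K := D.isCompact_drawing hV (hE.subset hSE)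
  have hsup : D.support = K ∪ Set.range (D.arc f) := by
    rw [hKdef, ← drawing_insert, Set.insert_sdiff_singleton, Set.insert_eq_of_mem hf]
    rfl
  have hsimple := D.arc_simple f hf
  have hio : ∀ t ∈ Set.Ioo (0 : I) 1, D.arc f t ∉ K := fun t ht => arc_notMem_drawing hSE hf hfS ht
  have h0 := D.arc_zero_mem_drawing (E(G) \ {f}) hf
  have h1 := D.arc_one_mem_drawing (E(G) \ {f}) hf
  have hcl := isClosed_support (D := D) hV hE
  obtain ⟨z, hz⟩ := D.openArc_nonempty f
  have hopen : D.openArc f ⊆ Kᶜ := by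
    rintro _ ⟨t, ht, rfl⟩
    exact hio t ht
  -- The region of the drawing without f that contains f. The faces bordering f are the pieces into
  -- which f divides it.
  set Ω := connectedComponentIn Kᶜ z with hΩ
  have hΩo : IsOpen Ω := hK.isClosed.isOpen_compl.connectedComponentIn
  have hsubΩ : D.openArc f ⊆ Ω :=
    (D.isPreconnected_openArc f).subset_connectedComponentIn hz hopen
  have hsame : ∀ p ∈ Ω, ∀ q ∈ Ω, q ∈ connectedComponentIn Kᶜ p := fun p hp q hq =>
    connectedComponentIn_eq hp ▸ hq
  have hcompl : ∀ w ∈ D.openArc f, w ∈ closure (D.supportᶜ ∩ Ω) := by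
    rintro _ ⟨t, ht, rfl⟩
    have := mem_closure_compl hK.isClosed hsimple hio h0 ht
    rw [← hsup] at this
    rw [Set.inter_comm]
    exact hΩo.inter_closure ⟨hsubΩ ⟨t, ht, rfl⟩, this⟩
  have hfront : ∀ p ∉ D.support, D.openArc f ⊆ closure (connectedComponentIn D.supportᶜ p) →
      connectedComponentIn D.supportᶜ p ∈ D.sides f := by
    intro p hp hpc
    refine ⟨component_mem_faces hp, fun w hw => ⟨hpc hw, fun h => ?_⟩⟩
    exact connectedComponentIn_subset _ _ (interior_subset h) (openArc_subset_support hf hw)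
  have hclosure : ∀ p ∈ Ω, p ∉ D.support →
      D.openArc f ⊆ closure (connectedComponentIn D.supportᶜ p) := by
    intro p hpΩ hp
    -- If f divides Ω, each part has all of f in its closure. Otherwise the single part does,
    -- because an arc has empty interior.
    by_cases hex : ∃ q ∈ Ω, q ∉ D.support ∧ q ∉ connectedComponentIn D.supportᶜ p
    · obtain ⟨q, hqΩ, hq, hqp⟩ := hex
      rw [hsup] at hp hq hqp ⊢
      rintro _ ⟨t, ht, rfl⟩
      exact mem_closure_component hK hsimple hio h0 h1 hp hq (hsame p hpΩ q hqΩ) hqp ht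
    · push Not at hex
      exact fun w hw => closure_mono (fun q hq => hex q hq.2 hq.1) (hcompl w hw)
  have hsides : ∀ p ∈ Ω, p ∉ D.support → connectedComponentIn D.supportᶜ p ∈ D.sides f :=
    fun p hpΩ hp => hfront p hp (hclosure p hpΩ hp)
  have hmeet : ∀ H ∈ D.sides f, ∃ q ∈ Ω, q ∉ D.support ∧ H = connectedComponentIn D.supportᶜ q := by
    intro H hH
    obtain ⟨q, hqΩ, hqH⟩ := mem_closure_iff.1 (frontier_subset_closure (hH.2 hz)) Ω hΩo (hsubΩ hz)
    exact ⟨q, hqΩ, subset_compl_support hH.1 hqH, eq_component_of_mem hH.1 hqH⟩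
  refine ⟨Ω, hΩo, hsubΩ, ?_, hsides, ?_⟩
  · rintro w ⟨hwΩ, hw⟩
    rw [hsup] at hw
    obtain hw | ⟨t, rfl⟩ := hw
    · exact (connectedComponentIn_subset _ _ hwΩ hw).elim
    · by_contra h
      have ht : t ∉ Set.Ioo (0 : I) 1 := fun ht => h ⟨t, ht, rfl⟩
      exact connectedComponentIn_subset _ _ hwΩ (D.arc_end_mem_drawing _ hf ht)
  · obtain ⟨p, hp, hpΩ⟩ := closure_nonempty_iff.1 ⟨z, hcompl z hz⟩
    by_cases hex : ∃ q ∈ Ω, q ∉ D.support ∧ q ∉ connectedComponentIn D.supportᶜ p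
    · obtain ⟨q, hqΩ, hq, hqp⟩ := hex
      refine ⟨_, _, Set.Subset.antisymm (fun H hH => ?_)
        (Set.insert_subset (hsides p hpΩ hp) (Set.singleton_subset_iff.2 (hsides q hqΩ hq)))⟩
      obtain ⟨r, hrΩ, hr, rfl⟩ := hmeet H hH
      by_contra hne
      rw [Set.mem_insert_iff, Set.mem_singleton_iff, not_or] at hne
      have hrp : r ∉ connectedComponentIn D.supportᶜ p := fun h =>
        hne.1 (connectedComponentIn_eq h).symm
      have hrq : r ∉ connectedComponentIn D.supportᶜ q := fun h =>
        hne.2 (connectedComponentIn_eq h).symm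
      rw [Set.mem_compl_iff] at hp
      rw [hsup] at hp hq hr hqp hrp hrq
      exact false_of_three_components hK hsimple hio h0 h1 hp hq hr (hsame p hpΩ r hrΩ)
        (hsame q hqΩ r hrΩ) hqp hrp hrq
    · push Not at hex
      refine ⟨_, _, Set.Subset.antisymm (fun H hH => ?_)
        (Set.insert_subset (hsides p hpΩ hp) (Set.singleton_subset_iff.2 (hsides p hpΩ hp)))⟩
      obtain ⟨r, hrΩ, hr, rfl⟩ := hmeet H hH
      exact Or.inl (connectedComponentIn_eq (hex r hrΩ hr)).symm

lemma edgeSet_dual (hV : V(G).Finite) (hE : E(G).Finite) : E(D.dual) = E(G) := by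
  ext f
  constructor
  · rintro ⟨F, F', hf, -⟩
    exact hf
  · intro hf
    obtain ⟨-, -, -, -, -, F, F', h⟩ := exists_sides (D := D) hV hE hf
    exact ⟨F, F', hf, h⟩

lemma mem_openArc_of_mem_support (hz : z ∈ D.support)
    (hzS : z ∉ D.drawing V(G) (E(G) \ S)) : ∃ f ∈ S, z ∈ D.openArc f := by
  rw [support_eq_drawing] at hz
  obtain ⟨v, hv, rfl⟩ | ⟨f, hf, t, ht, rfl⟩ := mem_drawing_vertexSet_cases subset_rfl hz
  · exact (hzS (D.pos_mem_drawing _ hv)).elim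
  · refine ⟨f, ?_, t, ht, rfl⟩
    by_contra h
    exact hzS (D.range_arc_subset_drawing _ (show f ∈ E(G) \ S from ⟨hf, h⟩) ⟨t, rfl⟩)

lemma openArc_subset_compl_drawing (hS : S ⊆ E(G)) (hf : f ∈ S) :
    D.openArc f ⊆ (D.drawing V(G) (E(G) \ S))ᶜ := by
  rintro _ ⟨t, ht, rfl⟩
  exact arc_notMem_drawing Set.sdiff_subset (hS hf) (fun h => h.2 hf) ht

lemma compl_support_subset (D : G.PlaneEmbedding) (S : Set β) :
    D.supportᶜ ⊆ (D.drawing V(G) (E(G) \ S))ᶜ :=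
  Set.compl_subset_compl.2 (D.drawing_mono subset_rfl Set.sdiff_subset)

lemma isPreconnected_union_openArc (hF : F ∈ D.sides f) : IsPreconnected (F ∪ D.openArc f) :=
  (isPreconnected_of_mem_faces hF.1).subset_closure Set.subset_union_left
    (Set.union_subset subset_closure (hF.2.trans frontier_subset_closure))

/-- A face stays connected when an open edge on its boundary is added, so faces adjacent across an
edge of S merge. Every point of the complement can be joined to some face, and dual walks join the
faces. -/
lemma isPreconnected_of_connectedOn (hV : V(G).Finite) (hE : E(G).Finite) (hS : S ⊆ E(G))
    (h : D.dual.ConnectedOn S) : IsPreconnected (D.drawing V(G) (E(G) \ S))ᶜ := by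
  set W := (D.drawing V(G) (E(G) \ S))ᶜ with hW
  have hface : ∀ F ∈ D.faces, F ⊆ W := fun F hF =>
    (subset_compl_support hF).trans (D.compl_support_subset S)
  have hside : ∀ f ∈ S, ∀ F ∈ D.sides f, F ∪ D.openArc f ⊆ W := fun f hf F hF =>
    Set.union_subset (hface F hF.1) (openArc_subset_compl_drawing hS hf)
  have key : ∀ z ∈ W, ∃ F ∈ D.faces, F ⊆ connectedComponentIn W z := by
    intro z hz
    by_cases hzs : z ∈ D.support
    · obtain ⟨f, hf, hzf⟩ := mem_openArc_of_mem_support hzs hz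
      obtain ⟨-, -, -, -, -, F, F', hs⟩ := exists_sides (D := D) hV hE (hS hf)
      have hF : F ∈ D.sides f := hs ▸ Or.inl rfl
      exact ⟨F, hF.1, Set.subset_union_left.trans ((isPreconnected_union_openArc
        hF).subset_connectedComponentIn (Or.inr hzf) (hside f hf F hF))⟩
    · exact ⟨_, component_mem_faces hzs, connectedComponentIn_mono _ (D.compl_support_subset S)⟩
  refine isPreconnected_of_forall_pair fun p hp q hq => ⟨_, connectedComponentIn_subset W p,
    mem_connectedComponentIn hp, ?_, isPreconnected_connectedComponentIn⟩
  obtain ⟨F, hF, hFp⟩ := key p hp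
  obtain ⟨F', hF', hFq⟩ := key q hq
  have hF'p : F' ⊆ connectedComponentIn W p := by
    refine (h F hF F' hF').closed (X := {H | H ⊆ connectedComponentIn W p}) hFp ?_
    rintro f hf H H' ⟨-, hs⟩ hH
    have hHs : H ∈ D.sides f := hs ▸ Or.inl rfl
    have hHs' : H' ∈ D.sides f := hs ▸ Or.inr rfl
    obtain ⟨w, hw⟩ := nonempty_of_mem_faces hHs.1
    obtain ⟨z, hz⟩ := D.openArc_nonempty f
    have h1 := (isPreconnected_union_openArc hHs).subset_connectedComponentIn (Or.inl hw)
      (hside f hf H hHs)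
    rw [← connectedComponentIn_eq (hH hw)] at h1
    have h2 := (isPreconnected_union_openArc hHs').subset_connectedComponentIn (Or.inr hz)
      (hside f hf H' hHs')
    rw [← connectedComponentIn_eq (h1 (Or.inr hz))] at h2
    exact Set.subset_union_left.trans h2
  obtain ⟨w, hw⟩ := nonempty_of_mem_faces hF'
  rw [connectedComponentIn_eq (hF'p hw), ← connectedComponentIn_eq (hFq hw)]
  exact mem_connectedComponentIn hq

/-- If some face is not reachable from F, the reachable faces and the others, each enlarged by
neighbourhoods of the edges of S between faces of the same kind, split the complement into two open
sets. -/
lemma connectedOn_of_isPreconnected (hV : V(G).Finite) (hE : E(G).Finite) (hS : S ⊆ E(G))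
    (h : IsPreconnected (D.drawing V(G) (E(G) \ S))ᶜ) : D.dual.ConnectedOn S := by
  intro F hF F' hF'
  by_contra hr
  have hex := fun f hf => exists_sides (D := D) (f := f) hV hE hf
  choose! Ω hΩo hΩa hΩs hΩf hpair using hex
  let A : Set (Set ℂ) → Set ℂ := fun R =>
    ⋃₀ {H | H ∈ D.faces ∧ H ∈ R} ∪ ⋃ f ∈ {f | f ∈ S ∧ D.sides f ⊆ R}, Ω f
  have hAo : ∀ R, IsOpen (A R) := fun R =>
    (isOpen_sUnion fun H hH => isOpen_of_mem_faces hV hE hH.1).union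
      (isOpen_biUnion fun f hf => hΩo f (hS hf.1))
  have hA1 : ∀ R z, z ∈ A R → z ∉ D.support → connectedComponentIn D.supportᶜ z ∈ R := by
    rintro R z (⟨H, hH, hz⟩ | hz) hzs
    · exact eq_component_of_mem hH.1 hz ▸ hH.2
    · simp only [Set.mem_iUnion] at hz
      obtain ⟨f, ⟨hfS, hfR⟩, hz⟩ := hz
      exact hfR (hΩf f (hS hfS) z hz hzs)
  have hA2 : ∀ R z, z ∈ A R → z ∈ D.support →
      ∃ f ∈ E(G), z ∈ D.openArc f ∧ D.sides f ⊆ R := by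
    rintro R z (⟨H, hH, hz⟩ | hz) hzs
    · exact (subset_compl_support hH.1 hz hzs).elim
    · simp only [Set.mem_iUnion] at hz
      obtain ⟨f, ⟨hfS, hfR⟩, hz⟩ := hz
      exact ⟨f, hS hfS, hΩs f (hS hfS) ⟨hz, hzs⟩, hfR⟩
  set R : Set (Set ℂ) := {H | D.dual.Reach S F H} with hR
  have hcover : (D.drawing V(G) (E(G) \ S))ᶜ ⊆ A R ∪ A Rᶜ := by
    intro z hz
    by_cases hzs : z ∈ D.support
    · obtain ⟨f, hf, hzf⟩ := mem_openArc_of_mem_support hzs hz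
      obtain ⟨H, H', hs⟩ := hpair f (hS hf)
      have hl : D.dual.IsLink f H H' := ⟨hS hf, hs⟩
      have hmem : ∀ Q, D.sides f ⊆ Q → z ∈ A Q := fun Q hQ => Or.inr
        (Set.mem_biUnion (show f ∈ {f | f ∈ S ∧ D.sides f ⊆ Q} from ⟨hf, hQ⟩)
          (hΩa f (hS hf) hzf))
      by_cases hH : D.dual.Reach S F H
      · refine Or.inl (hmem R ?_)
        rw [hs]
        exact Set.insert_subset hH (Set.singleton_subset_iff.2 (hH.trans (hl.reach hf)))
      · refine Or.inr (hmem Rᶜ ?_)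
        rw [hs]
        exact Set.insert_subset hH (Set.singleton_subset_iff.2 fun h =>
          hH (Reach.trans h (hl.reach hf).symm))
    · by_cases hH : connectedComponentIn D.supportᶜ z ∈ R
      · exact Or.inl (Or.inl ⟨_, ⟨component_mem_faces hzs, hH⟩, mem_connectedComponentIn hzs⟩)
      · exact Or.inr (Or.inl ⟨_, ⟨component_mem_faces hzs, hH⟩, mem_connectedComponentIn hzs⟩)
  obtain ⟨p, hp⟩ := nonempty_of_mem_faces hF
  obtain ⟨q, hq⟩ := nonempty_of_mem_faces hF'
  -- A common point z is impossible: off the drawing its face would be of both kinds, and on the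
  -- drawing the sides of its edge would.
  obtain ⟨z, -, hz1, hz2⟩ := h (A R) (A Rᶜ) (hAo R) (hAo Rᶜ) hcover
    ⟨p, D.compl_support_subset S (subset_compl_support hF hp),
      Or.inl ⟨F, ⟨hF, .refl _ _ _⟩, hp⟩⟩
    ⟨q, D.compl_support_subset S (subset_compl_support hF' hq), Or.inl ⟨F', ⟨hF', hr⟩, hq⟩⟩
  by_cases hzs : z ∈ D.support
  · obtain ⟨f, hf, ⟨t, ht, htz⟩, hfR⟩ := hA2 R z hz1 hzs
    obtain ⟨g, hg, ⟨s, hs, hsz⟩, hgR⟩ := hA2 Rᶜ z hz2 hzs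
    have hfg : f = g := by
      by_contra hfg
      exact D.arc_disjoint f hf g hg hfg t ht s hs (htz.trans hsz.symm)
    subst hfg
    obtain ⟨H, H', hs⟩ := hpair f hf
    have hH : H ∈ D.sides f := hs ▸ Or.inl rfl
    exact hgR hH (hfR hH)
  · exact hA1 Rᶜ z hz2 hzs (hA1 R z hz1 hzs)

/-- The geometric dual of a plane graph is a dual in the combinatorial sense. -/
theorem isDual_dual (D : G.PlaneEmbedding) (hV : V(G).Finite) (hE : E(G).Finite) :
    IsDual G D.dual := by
  refine ⟨edgeSet_dual hV hE, fun S hS => ⟨fun h => ?_, fun h => ?_⟩⟩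
  · by_contra hac
    exact not_isPreconnected_compl_drawing hV hE Set.sdiff_subset hac
      (isPreconnected_of_connectedOn hV hE hS h)
  · exact connectedOn_of_isPreconnected hV hE hS
      (isPreconnected_compl_drawing hV hE Set.sdiff_subset h)

end Dual

end PlaneEmbedding

end Graph

theorem mainTheorem8 {α β : Type*} (G : Graph α β) (hV : V(G).Finite) (hE : E(G).Finite)
    (hG : G.Connected) (D : G.PlaneEmbedding) (e : β) (he : e ∈ E(G)) :
    (∀ T : Graph α β, G.IsSpanningTree T → e ∈ E(T) →
      (Graph.IsRootedAt (G.fundamentalCycles T) e ↔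
        ∃ C : Graph (Set ℂ) β, D.dual.IsHamiltonianCycle C ∧ E(C) = (E(G) \ E(T)) ∪ {e})) ∧
    ((∀ v, ¬ G.IsLoopAt e v) →
      ((∃ B : Set (Graph α β), G.IsRootedFundamentalCycleBasis e B) ↔
        ∃ C : Graph (Set ℂ) β, D.dual.IsHamiltonianCycle C ∧ e ∈ E(C))) := by
  have hD := D.isDual_dual hV hE
  exact ⟨fun T hT heT => hD.isRootedAt_iff hE hT heT,
    hD.exists_isRootedFundamentalCycleBasis_iff hE hG he⟩
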